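/- **Setting.** A game $\mathcal G$ (a $2\tfrac12$-player game) consists of a possibly infinite set $S$ of states, partitioned into states $S^0$ of Player $0$, states $S^1$ of Player $1$ and random states $S^R$; a transition relation $\to$ such that every state has at least one and at most countably many successors; for each random state $s$ a probability distribution $P(s,\cdot)$ with $P(s,s')>0\iff s\to s'$; and a coloring $\mathrm{Col}:S\to\mathbb N$. It has rank $n$ if all colors are in $\{0,\dots,n\}$. A strategy of Player $x$ is a partial function $f$ that maps paths $s_0\cdots s_k$ with $s_k\in S^x$ to a successor of $s_k$. It is total if it is defined on all such paths, and memoryless if its value (or its being undefined) depends only on $s_k$. It is finite-memory if it is total and induced by a memory structure $(M,m_0,\tau,\mu)$ with $M$ finite, i.e. $f(s_0\cdots s_k)=\tau(s_k,m_k)$, where $m_{i+1}=\mu(s_i,m_i)$. An initial state $s$ and two total strategies determine a probability measure on $S^\omega$. For partial strategies, a statement about the probability of a set of runs means that it holds for all pairs of total extensions of the strategies. A set $A\subseteq S$ is an attractor if, from every state and for all strategies of the two players, $A$ is reached with probability $1$. The condition $x$-Parity says that the largest color that occurs infinitely often is congruent to $x$ modulo $2$. For a set $T$ of states, $\mathit{Force}^x(\mathcal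 G,T)=R_\gamma$, where $R_0=T$, $R_\lambda=\bigcup_{\alpha<\lambda}R_\alpha$ for limit ordinals $\lambda$, $R_{\alpha+1}$ is obtained from $R_\alpha$ by adding the states in $S^R\cup S^x$ with some successor in $R_\alpha$ and the states in $S^{1-x}$ with all successors in $R_\alpha$, and $\gamma$ is the least ordinal with $R_\gamma=R_{\gamma+1}$. If every state in $S\setminus Q$ has a successor in $S\setminus Q$, and all successors of random states in $S\setminus Q$ are in $S\setminus Q$, then $\mathcal G\ominus Q$ denotes the sub-game with state set $S\setminus Q$; complements of force sets have this property. Define $\mathcal C_0(\mathcal G)=S$. For $n\ge 1$ and $x=n\bmod 2$ define, by recursion on the ordinal $\alpha$, $$X_\alpha=\mathit{Force}^{1-x}\Big(\mathcal G,\bigcup_{\beta<\alpha}Y_\beta\Big),$$ $$Z_\alpha=\mathit{Force}^{x}\big(\mathcal G\ominus X_\alpha,\{s\in S\setminus X_\alpha:\mathrm{Col}(s)=n\}\big),$$ $$Y_\alpha=X_\alpha\cup \mathcal C_{n-1}(\mathcal G\ominus X_\alpha\ominus Z_\alpha),$$ and $\mathcal C_n(\mathcal G)=S\setminus X_\gamma$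 for the least ordinal $\gamma$ with $X_{\gamma+1}=X_\gamma$. **Theorem.** Let $\mathcal G$ be a game of rank $n$ that has a finite attractor, and let $x=n\bmod 2$. 1. There are memoryless strategies $f$ of Player $x$ and $g$ of Player $1-x$ such that * from every state in $\mathcal C_n(\mathcal G)$, the strategy $f$ ensures $x$-Parity with probability $1$ against every finite-memory strategy of Player $1-x$; * from every state in $S\setminus\mathcal C_n(\mathcal G)$, the strategy $g$ ensures $(1-x)$-Parity with positive probability against every finite-memory strategy of Player $x$. 2. With both players restricted to finite-memory strategies, the game is memoryless determined for almost-sure and for positive-probability parity objectives. That is, for each player $y\in\{0,1\}$, each of the conditions "$=1$" and "$>0$" on the probability of $y$-Parity, and every state $s$, at least one of the following holds: Player $y$ has a memoryless (finite-memory) strategy that ensures the condition from $s$ against every finite-memory strategy of Player $1-y$; or Player $1-y$ has a memoryless (finite-memory) strategy that ensures the negation of the condition from $s$ against every finite-memory strategy of Player $y$. -/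

import Mathlib

open MeasureTheory ProbabilityTheory Filter
open scoped ENNReal

universe u

/-- The two players `0` and `1`; the opponent of `x` is `1 - x`. -/
abbrev Player : Type := Fin 2

/-- The player `n mod 2`. -/
def Player.ofNat (n : ℕ) : Player := ⟨n % 2, Nat.mod_lt n (by decide)⟩

theorem Player.owner_cases : ∀ (o : Option Player) (x : Player),
    ¬ (o = none ∨ o = some x) → o = some (1 - x) := by
  decide

/-- A 2½-player game with a coloring. Its set of states is a (possibly empty, possibly infinite)
set `states` of elements of an ambient type `V`. -/
structure StochasticGame (V : Type u) where
  /-- the set of states -/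
  states : Set V
  /-- `owner s = some x` if `s` is a state of Player `x`, `owner s = none` if `s` is random -/
  owner : V → Option Player
  /-- the transition relation -/
  trans : V → V → Prop
  /-- the probability distribution over successors (used at random states only) -/
  P : V → PMF V
  /-- the coloring function (used at states only) -/
  col : V → ℕ
  trans_mem : ∀ {s t}, trans s t → s ∈ states ∧ t ∈ states
  exists_succ : ∀ s ∈ states, ∃ t, trans s t
  countable_succ : ∀ s, {t | trans s t}.Countable
  P_pos_iff : ∀ s ∈ states, owner s = none → ∀ t, 0 < P s t ↔ trans s t

/-- A nonempty finite word `s₀ ⋯ sₙ`, split into `past = s₀ ⋯ sₙ₋₁` and `cur = sₙ`. -/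
structure Hist (V : Type u) where
  past : List V
  cur : V

/-- The set of finite words carries the discrete σ-algebra. -/
instance (V : Type u) : MeasurableSpace (Hist V) := ⊤

namespace StochasticGame

variable {V : Type u}

/-- All colors are in `{0, …, n}`. -/
def HasRank (G : StochasticGame V) (n : ℕ) : Prop := ∀ s ∈ G.states, G.col s ≤ n

/-! ### Strategies -/

/-- `h` is a path of the game. -/
def IsPath (G : StochasticGame V) (h : Hist V) : Prop :=
  h.cur ∈ G.states ∧ List.IsChain G.trans (h.past ++ [h.cur])

/-- `h` is a path of the game that ends in a state of Player `x`. -/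
def IsPathOf (G : StochasticGame V) (x : Player) (h : Hist V) : Prop :=
  G.IsPath h ∧ G.owner h.cur = some x

/-- A (partial) strategy of Player `x`; `move h = none` means that it is undefined at `h`. Only the
values of `move` at paths that end in a state of Player `x` have a meaning. -/
structure Strategy (G : StochasticGame V) (x : Player) where
  move : Hist V → Option V
  legal : ∀ h, G.IsPathOf x h → ∀ t, move h = some t → G.trans h.cur t

namespace Strategy

variable {G : StochasticGame V} {x : Player}

def IsTotal (f : G.Strategy x) : Prop := ∀ h, G.IsPathOf x h → f.move h ≠ none

/-- `g` is an extension of `f`. -/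
def Extends (g f : G.Strategy x) : Prop :=
  ∀ h, G.IsPathOf x h → ∀ t, f.move h = some t → g.move h = some t

/-- The next state (or its being undefined) depends on the current state only. -/
def IsMemoryless (f : G.Strategy x) : Prop :=
  ∀ h, G.IsPathOf x h → f.move h = f.move ⟨[], h.cur⟩

end Strategy

/-- A memory structure for Player `x` with memory `M`. -/
structure MemoryStructure (G : StochasticGame V) (x : Player) (M : Type) where
  /-- the initial memory configuration -/
  init : M
  /-- the next state -/
  next : V → M → V
  /-- the next memory configuration -/
  update : V → M → M
  legal : ∀ s ∈ G.states, G.owner s = some x → ∀ m, G.trans s (next s m)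

/-- The memory configuration after a finite word has been read. -/
def MemoryStructure.run {G : StochasticGame V} {x : Player} {M : Type}
    (𝓜 : G.MemoryStructure x M) (w : List V) : M :=
  w.foldl (fun m s => 𝓜.update s m) 𝓜.init

/-- `f` is total and induced by a memory structure with a finite memory. -/
def Strategy.IsFiniteMemory {G : StochasticGame V} {x : Player} (f : G.Strategy x) : Prop :=
  f.IsTotal ∧ ∃ (M : Type) (_ : Finite M) (𝓜 : G.MemoryStructure x M),
    ∀ h, G.IsPathOf x h → f.move h = some (𝓜.next h.cur (𝓜.run h.past))

/-- The set of finite-memory strategies of each player. -/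
def finiteMemory (G : StochasticGame V) (x : Player) : Set (G.Strategy x) :=
  {f | f.IsFiniteMemory}

/-! ### The probability of a set of runs -/

/-- One strategy for each player. -/
abbrev Profile (G : StochasticGame V) : Type u := ∀ x : Player, G.Strategy x

/-- The distribution of the next state after `h` (the default value `h.cur` is never used for total
strategies along paths of the game). -/
noncomputable def step (G : StochasticGame V) (σ : G.Profile) (h : Hist V) : PMF V :=
  match G.owner h.cur with
  | none => G.P h.cur
  | some x => PMF.pure (((σ x).move h).getD h.cur)

/-- The distribution of the word `s₀ ⋯ sₙ sₙ₊₁` given the word `h = s₀ ⋯ sₙ`. -/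
noncomputable def stepHist (G : StochasticGame V) (σ : G.Profile) (h : Hist V) : PMF (Hist V) :=
  (G.step σ h).map fun t => ⟨h.past ++ [h.cur], t⟩

/-- The transition kernel of the Markov chain of finite prefixes of the run, at time `k`. -/
noncomputable def histKernel (G : StochasticGame V) (σ : G.Profile) (k : ℕ) :
    Kernel ((_ : Finset.Iic k) → Hist V) (Hist V) where
  toFun ω := (G.stepHist σ (ω ⟨k, Finset.mem_Iic.2 le_rfl⟩)).toMeasure
  measurable' :=
    (measurable_from_top (f := fun h : Hist V => (G.stepHist σ h).toMeasure)).comp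
      (measurable_pi_apply _)

instance (G : StochasticGame V) (σ : G.Profile) (k : ℕ) : IsMarkovKernel (G.histKernel σ k) :=
  ⟨fun _ => by
    change IsProbabilityMeasure (PMF.toMeasure _)
    infer_instance⟩

/-- The law of the sequence of finite prefixes of the run that starts in `s`. -/
noncomputable def histMeasure (G : StochasticGame V) (σ : G.Profile) (s : V) :
    Measure (ℕ → Hist V) :=
  Kernel.traj (X := fun _ => Hist V) (G.histKernel σ) 0 fun _ => ⟨[], s⟩

/-- The probability that the run from `s` under the total strategies `σ` belongs to `E`. -/
noncomputable def prob (G : StochasticGame V) (σ : G.Profile) (s : V) (E : Set (ℕ → V)) : ℝ≥0∞ :=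
  G.histMeasure σ s {ω | (fun k => (ω k).cur) ∈ E}

/-- The condition `c` on the probability of `E` for partial strategies: it holds for all total
extensions. -/
def ProbHolds (G : StochasticGame V) {x : Player} (s : V) (f : G.Strategy x)
    (g : G.Strategy (1 - x)) (E : Set (ℕ → V)) (c : ℝ≥0∞ → Prop) : Prop :=
  ∀ σ : G.Profile, (∀ y, (σ y).IsTotal) → (σ x).Extends f → (σ (1 - x)).Extends g →
    c (G.prob σ s E)

/-! ### Winning conditions -/

/-- The runs whose largest color that occurs infinitely often is `≡ x` modulo `2`. -/
def parity (G : StochasticGame V) (x : Player) : Set (ℕ → V) :=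
  {ρ | ∃ i : ℕ, Player.ofNat i = x ∧
    (∃ᶠ k in atTop, G.col (ρ k) = i) ∧ ∀ᶠ k in atTop, G.col (ρ k) ≤ i}

/-- The states at which the strategy `f` of Player `x` wins the objective "the probability of `E`
satisfies `c`" against all total strategies of the opponent in `F`. -/
def winSet (G : StochasticGame V) {x : Player} (f : G.Strategy x) (F : Set (G.Strategy (1 - x)))
    (E : Set (ℕ → V)) (c : ℝ≥0∞ → Prop) : Set V :=
  {s | s ∈ G.states ∧ ∀ g ∈ F, g.IsTotal → G.ProbHolds s f g E c}

/-- Almost surely. -/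
def AS (p : ℝ≥0∞) : Prop := p = 1

/-- With positive probability. -/
def WPP (p : ℝ≥0∞) : Prop := 0 < p

/-- The game is memoryless determined with respect to the objective "the probability of `E`
satisfies `c`" of Player `x` and the sets `F 0`, `F 1` of strategies of the players: from every
state, either Player `x` has a memoryless strategy in `F x` that enforces the objective against
every strategy in `F (1 - x)`, or Player `1 - x` has a memoryless strategy in `F (1 - x)` that
enforces the negated objective against every strategy in `F (1 - (1 - x)) = F x`. -/
def MemorylessDetermined (G : StochasticGame V) (x : Player) (F : ∀ y, Set (G.Strategy y))
    (E : Set (ℕ → V)) (c : ℝ≥0∞ → Prop) : Prop :=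
  ∀ s ∈ G.states,
    (∃ f ∈ F x, f.IsMemoryless ∧ s ∈ G.winSet f (F (1 - x)) E c) ∨
    (∃ g ∈ F (1 - x), g.IsMemoryless ∧
      s ∈ G.winSet g (F (1 - (1 - x))) E (fun p => ¬ c p))

/-- `A` is an attractor: it is reached almost surely, from every state and whatever the players
do. -/
def IsAttractor (G : StochasticGame V) (A : Set V) : Prop :=
  A ⊆ G.states ∧ ∀ s ∈ G.states, ∀ σ : G.Profile, (∀ y, (σ y).IsTotal) →
    G.prob σ s {ρ | ∃ k, ρ k ∈ A} = 1

/-! ### Force sets -/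

/-- The predecessors of `Q`. -/
def pre (G : StochasticGame V) (Q : Set V) : Set V := {s | ∃ t ∈ Q, G.trans s t}

/-- The states all of whose successors belong to `Q`. -/
def dualPre (G : StochasticGame V) (Q : Set V) : Set V := G.states \ G.pre (G.states \ Q)

/-- `Q` is closable: every state in `Q` has a successor in `Q`, and all successors of random states
in `Q` belong to `Q`. -/
def Closable (G : StochasticGame V) (Q : Set V) : Prop :=
  (∀ s ∈ Q, ∃ t ∈ Q, G.trans s t) ∧
  ∀ s ∈ Q, G.owner s = none → ∀ t, G.trans s t → t ∈ Q

/-- The transfinite sequence `R_α` of states from which Player `x` can force a visit to `T`. -/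
noncomputable def reach (G : StochasticGame V) (x : Player) (T : Set V) (α : Ordinal.{u}) :
    Set V :=
  Ordinal.limitRecOn α T
    (fun _ R => R ∪ (G.pre R ∩ {s | G.owner s = none}) ∪ (G.pre R ∩ {s | G.owner s = some x}) ∪
      (G.dualPre R ∩ {s | G.owner s = some (1 - x)}))
    (fun α _ R => ⋃ β : Set.Iio α, R β.1 β.2)

/-- `R_γ` for the least `γ` such that `R_γ = R_{γ+1}`. -/
noncomputable def force (G : StochasticGame V) (x : Player) (T : Set V) : Set V :=
  G.reach x T (sInf {γ | G.reach x T γ = G.reach x T (γ + 1)})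

theorem reach_succ (G : StochasticGame V) (x : Player) (T : Set V) (α : Ordinal.{u}) :
    G.reach x T (α + 1) = G.reach x T α ∪ (G.pre (G.reach x T α) ∩ {s | G.owner s = none}) ∪
      (G.pre (G.reach x T α) ∩ {s | G.owner s = some x}) ∪
      (G.dualPre (G.reach x T α) ∩ {s | G.owner s = some (1 - x)}) := by
  simp only [reach, Ordinal.limitRecOn_add_one]

theorem reach_mono (G : StochasticGame V) (x : Player) (T : Set V) :
    Monotone (G.reach x T) := by
  intro α β
  induction β using Ordinal.limitRecOn with
  | zero => intro h; rw [nonpos_iff_eq_zero.1 h]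
  | add_one β ih =>
    intro h
    rcases h.lt_or_eq with h | rfl
    · refine (ih (Order.lt_succ_iff.1 (by simpa using h))).trans ?_
      rw [reach_succ]
      exact fun s hs => Or.inl (Or.inl (Or.inl hs))
    · exact le_rfl
  | limit β hβ ih =>
    intro h
    rcases h.lt_or_eq with h | rfl
    · have : G.reach x T β = ⋃ α : Set.Iio β, G.reach x T α.1 := by
        simp only [reach]
        rw [Ordinal.limitRecOn_limit _ _ _ _ hβ]
      rw [this]
      exact Set.subset_iUnion (fun α : Set.Iio β => G.reach x T α.1) ⟨α, h⟩
    · exact le_rfl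

theorem force_fixed (G : StochasticGame V) (x : Player) (T : Set V) :
    ∃ γ, G.force x T = G.reach x T γ ∧ G.reach x T γ = G.reach x T (γ + 1) := by
  have hne : {γ | G.reach x T γ = G.reach x T (γ + 1)}.Nonempty := by
    by_contra hcon
    rw [Set.not_nonempty_iff_eq_empty] at hcon
    refine not_injective_of_ordinal.{u} (G.reach x T) (StrictMono.injective ?_)
    intro α β h
    have h1 : G.reach x T α < G.reach x T (α + 1) := by
      refine lt_of_le_of_ne (G.reach_mono x T (by simp)) fun he => ?_
      have : α ∈ ({γ | G.reach x T γ = G.reach x T (γ + 1)} : Set Ordinal.{u}) := he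
      rw [hcon] at this
      exact this
    exact h1.trans_le (G.reach_mono x T (by simpa using Order.succ_le_of_lt h))
  exact ⟨_, rfl, csInf_mem hne⟩

/-- The complement of a force set is closable. -/
theorem closable_compl_force (G : StochasticGame V) (x : Player) (T : Set V) :
    G.Closable (G.states \ G.force x T) := by
  obtain ⟨γ, h1, h2⟩ := G.force_fixed x T
  rw [h1]
  rw [reach_succ] at h2
  set R := G.reach x T γ
  have key : ∀ s ∈ G.states \ R, G.owner s = none ∨ G.owner s = some x →
      ∀ t, G.trans s t → t ∈ G.states \ R := by
    intro s hs ho t hst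
    refine ⟨(G.trans_mem hst).2, fun ht => hs.2 ?_⟩
    rw [h2]
    rcases ho with ho | ho
    · exact Or.inl (Or.inl (Or.inr ⟨⟨t, ht, hst⟩, ho⟩))
    · exact Or.inl (Or.inr ⟨⟨t, ht, hst⟩, ho⟩)
  refine ⟨fun s hs => ?_, fun s hs ho => key s hs (Or.inl ho)⟩
  by_cases ho : G.owner s = none ∨ G.owner s = some x
  · obtain ⟨t, ht⟩ := G.exists_succ s hs.1
    exact ⟨t, key s hs ho t ht, ht⟩
  · have ho' : G.owner s = some (1 - x) := by
      exact Player.owner_cases (G.owner s) x ho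
    by_contra hcon
    refine hs.2 ?_
    rw [h2]
    exact Or.inr ⟨⟨hs.1, hcon⟩, ho'⟩

/-! ### Sub-games and the sets `C_n` -/

/-- The sub-game `G ⊖ Q`. -/
def sub (G : StochasticGame V) (Q : Set V) (hQ : G.Closable (G.states \ Q)) :
    StochasticGame V where
  states := G.states \ Q
  owner := G.owner
  trans s t := G.trans s t ∧ s ∈ G.states \ Q ∧ t ∈ G.states \ Q
  P := G.P
  col := G.col
  trans_mem h := h.2
  exists_succ s hs := by
    obtain ⟨t, ht, h⟩ := hQ.1 s hs
    exact ⟨t, h, hs, ht⟩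
  countable_succ s := (G.countable_succ s).mono fun _ h => h.1
  P_pos_iff s hs ho t := by
    rw [G.P_pos_iff s hs.1 ho t]
    exact ⟨fun h => ⟨h, hs, hQ.2 s hs ho t h⟩, fun h => h.1⟩

/-- The sub-game `G ⊖ Force^x(G, T)`. -/
noncomputable def subForce (G : StochasticGame V) (x : Player) (T : Set V) : StochasticGame V :=
  G.sub (G.force x T) (G.closable_compl_force x T)

/-- The transfinite sequence `Y_α = step (⋃_{β < α} Y_β)`. -/
noncomputable def iter (step : Set V → Set V) (α : Ordinal.{u}) : Set V :=
  step (⋃ β : Set.Iio α, iter step β.1)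
termination_by α
decreasing_by exact β.2

/-- The sets `C_n(G)`. In the successor case `x = n + 1 mod 2`, and for all ordinals `α`

* `X α = Force^{1-x}(G, ⋃_{β<α} Y β)`,
* `Z α = Force^x(G ⊖ X α, {states of G ⊖ X α of color n + 1})`,
* `Y α = X α ∪ C_n(G ⊖ X α ⊖ Z α)`.

The result is the complement of `X γ` for the least `γ` with `X (γ + 1) = X γ`. -/
noncomputable def C : ℕ → StochasticGame V → Set V
  | 0, G => G.states
  | n + 1, G =>
    let x : Player := Player.ofNat (n + 1)
    let stepY : Set V → Set V := fun U =>
      let G' := G.subForce (1 - x) U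
      G.force (1 - x) U ∪ C n (G'.subForce x {s ∈ G'.states | G'.col s = n + 1})
    let Y : Ordinal.{u} → Set V := iter stepY
    let X : Ordinal.{u} → Set V := fun α => G.force (1 - x) (⋃ β : Set.Iio α, Y β.1)
    G.states \ X (sInf {γ | X (γ + 1) = X γ})

end StochasticGame

/-!
# Memoryless determinacy of stochastic parity games against finite memory

If one player uses a memoryless strategy and the opponent a finite memory structure, then the play
is a Markov chain on pairs of a state and a memory configuration. A finite attractor of the game
gives a finite set of pairs that is visited almost surely from everywhere, and this makes the parity
condition a property of the graph of the chain: almost surely the play enters a *bottom* state, that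
is, a state which is reachable from everything that it reaches; from there it visits all reachable
states infinitely often, so that the largest reachable color decides the parity condition
(`Follows.ae_parity`). The reason is `MarkovChain.hitProb_eq_one`: if `D` is reachable from all
states of a closed set `K`, then the infimum `c` over `K` of the probability of a visit to `D`
satisfies `c + q * (1 - c) ≤ c` for some `q > 0`, as a path to `D` yields such a gain at the
finitely many states of the attractor. Hence a player wins almost surely if all reachable bottom states have
a good color (`WinsAS.prob_eq_one`), and with positive probability if some of them has one
(`WinsPos.prob_pos`).

The rest is a statement about graphs, `exists_winning`, proved by induction on the rank `n` for all
games at once. The attractor enters only through the fact that it meets every nonempty closable set,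
which passes to sub-games and ensures that bottom states are reachable
(`exists_reachable_isBottom`). With `x ≡ n`:

* The complement of `C_n` is a union of layers. In a layer, Player `1 - x` either forces the play
  into an earlier layer, or plays a strategy that is given by the induction hypothesis and wins
  almost surely in the core of the layer, which Player `x` can leave only towards the force set of
  the earlier layers. By transfinite induction, a good bottom state is always reachable
  (`exists_winsPos_layers`).
* On `C_n` the core of the last layer contains no state of `C_{n-1}`, so by the induction hypothesis
  Player `x` wins with positive probability in all of it. If a bottom state reaches the set from
  which he forces color `n`, its largest color is `n`; otherwise its component is contained in the
  core, where some reachable bottom state, necessarily in the same component, has a good color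
  (`exists_winsAS_of_winsPos`).

A game of rank `n` has rank `n + 1` as well. So each player can be taken to be the one who wins
almost surely on `C_m`, which gives both parts of the determinacy statement.
-/

/-! ### Homogeneous Markov chains on discrete spaces -/

namespace MarkovChain

variable {W : Type*}

section Trajectory

variable [MeasurableSpace W]

/-- The initial segment `y₁, …, y_{b+1}` of a sequence, renumbered to start at `0`. -/
def shiftRestrict (b : ℕ) (y : (_ : Finset.Iic (b + 1)) → W) : (_ : Finset.Iic b) → W :=
  fun i => y ⟨i.1 + 1, Finset.mem_Iic.2 (Nat.succ_le_succ (Finset.mem_Iic.1 i.2))⟩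

theorem measurable_shiftRestrict (b : ℕ) : Measurable (shiftRestrict (W := W) b) :=
  measurable_pi_lambda _ fun _ => measurable_pi_apply _

variable [DiscreteMeasurableSpace W]

/-- The transition function `κ` of a homogeneous Markov chain on a discrete space, as the kernel
that produces the state at time `k + 1` from the states up to time `k`. -/
noncomputable def stepKernel (κ : W → PMF W) (k : ℕ) : Kernel ((_ : Finset.Iic k) → W) W where
  toFun ω := (κ (ω ⟨k, Finset.mem_Iic.2 le_rfl⟩)).toMeasure
  measurable' := (Measurable.of_discrete (f := fun w : W => (κ w).toMeasure)).comp
    (measurable_pi_apply _)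

instance (κ : W → PMF W) (k : ℕ) : IsMarkovKernel (stepKernel κ k) :=
  ⟨fun _ => by
    change IsProbabilityMeasure (PMF.toMeasure _)
    infer_instance⟩

/-- The law of the Markov chain with transition function `κ` that starts in `w`. -/
noncomputable def law (κ : W → PMF W) (w : W) : Measure (ℕ → W) :=
  Kernel.traj (X := fun _ => W) (stepKernel κ) 0 fun _ => w

instance (κ : W → PMF W) (w : W) : IsProbabilityMeasure (law κ w) := by
  unfold law; infer_instance

/-- The one-step extension of an initial segment appends a state with law `κ (y b)`. -/
theorem partialTraj_succ_apply (κ : W → PMF W) (b : ℕ) (y : (_ : Finset.Iic b) → W)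
    {S : Set ((_ : Finset.Iic (b + 1)) → W)} (hS : MeasurableSet S) :
    Kernel.partialTraj (X := fun _ => W) (stepKernel κ) b (b + 1) y S =
      (κ (y ⟨b, Finset.mem_Iic.2 le_rfl⟩)).toMeasure
        {t | (fun i : Finset.Iic (b + 1) => if h : i.1 ≤ b then y ⟨i.1, Finset.mem_Iic.2 h⟩ else t)
          ∈ S} := by
  have := Kernel.IsMarkovKernel.map (stepKernel κ b)
    (MeasurableEquiv.piSingleton (X := fun _ => W) b).measurable
  rw [Kernel.partialTraj_succ_self,
    Kernel.map_apply' _ (measurable_IicProdIoc (X := fun _ : ℕ => W)) _ hS,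
    Kernel.id_prod_apply', Kernel.map_apply' _ (by fun_prop)]
  · change (κ _).toMeasure _ = _
    congr 1
    ext t
    simp only [Set.mem_preimage, Set.mem_ofPred_eq]
    congr! 1
    ext i
    simp [IicProdIoc, MeasurableEquiv.piSingleton]
  · exact measurable_prodMk_left (measurable_IicProdIoc (X := fun _ : ℕ => W) hS)
  · exact measurable_IicProdIoc (X := fun _ : ℕ => W) hS

theorem partialTraj_shift (κ : W → PMF W) (b : ℕ) (x : (_ : Finset.Iic 1) → W) :
    (Kernel.partialTraj (X := fun _ => W) (stepKernel κ) 1 (b + 1) x).map (shiftRestrict b) =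
      Kernel.partialTraj (X := fun _ => W) (stepKernel κ) 0 b
        (fun _ => x ⟨1, Finset.mem_Iic.2 le_rfl⟩) := by
  induction b with
  | zero =>
    change (Kernel.partialTraj (X := fun _ => W) (stepKernel κ) 1 1 x).map (shiftRestrict 0) = _
    rw [Kernel.partialTraj_self, Kernel.partialTraj_self, Kernel.id_apply, Kernel.id_apply,
      Measure.map_dirac' (measurable_shiftRestrict 0)]
    congr 1
    ext i
    have : i.1 = 0 := Nat.le_zero.1 (Finset.mem_Iic.1 i.2)
    simp [shiftRestrict, this]
  | succ b ih =>
    ext S hS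
    rw [Measure.map_apply (measurable_shiftRestrict _) hS,
      Kernel.partialTraj_succ_eq_comp (show 1 ≤ b + 1 by omega),
      Kernel.partialTraj_succ_eq_comp (show 0 ≤ b by omega),
      Kernel.comp_apply' _ _ _ (measurable_shiftRestrict _ hS), Kernel.comp_apply' _ _ _ hS, ← ih,
      lintegral_map (Kernel.measurable_coe _ hS) (measurable_shiftRestrict _)]
    congr 1
    ext y
    rw [partialTraj_succ_apply κ _ _ (measurable_shiftRestrict _ hS),
      partialTraj_succ_apply κ _ _ hS]
    congr 1
    ext t
    simp only [Set.mem_preimage, Set.mem_ofPred_eq]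
    congr! 1
    ext i
    simp [shiftRestrict]

/-- Homogeneity: the chain observed up to time `1` continues, after a shift, like the chain that
starts in the state at time `1`. -/
theorem traj_shift (κ : W → PMF W) (x : (_ : Finset.Iic 1) → W) :
    (Kernel.traj (X := fun _ => W) (stepKernel κ) 1 x).map (fun ω n => ω (n + 1)) =
      law κ (x ⟨1, Finset.mem_Iic.2 le_rfl⟩) := by
  have hm : Measurable (fun (ω : ℕ → W) n => ω (n + 1)) :=
    measurable_pi_lambda _ fun _ => measurable_pi_apply _
  have : IsProbabilityMeasure ((Kernel.traj (X := fun _ => W) (stepKernel κ) 1 x).map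
      fun ω n => ω (n + 1)) := Measure.isProbabilityMeasure_map hm.aemeasurable
  have (I : Finset ℕ) : IsFiniteMeasure (inducedFamily (X := fun _ => W) (fun n =>
      Kernel.partialTraj (X := fun _ => W) (stepKernel κ) 0 n
        fun _ => x ⟨1, Finset.mem_Iic.2 le_rfl⟩) I) :=
    by rw [inducedFamily]; infer_instance
  refine ((Kernel.isProjectiveLimit_trajFun (X := fun _ => W) (stepKernel κ) 0
    fun _ => x ⟨1, Finset.mem_Iic.2 le_rfl⟩).unique ?_).symm
  rw [isProjectiveLimit_nat_iff (Kernel.isProjectiveMeasureFamily_partialTraj _ _)]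
  intro b
  rw [inducedFamily_Iic, ← partialTraj_shift, ← Kernel.traj_map_frestrictLe_apply,
    Measure.map_map (by fun_prop) hm,
    Measure.map_map (measurable_shiftRestrict _) (by fun_prop)]
  rfl

theorem lintegral_toMeasure (p : PMF W) (f : W → ℝ≥0∞) :
    ∫⁻ w, f w ∂p.toMeasure = ∑' w, p w * f w := by
  have : p.toMeasure = Measure.sum fun w => p w • Measure.dirac w := by
    ext s hs
    rw [PMF.toMeasure_apply _ hs, Measure.sum_apply _ hs]
    refine tsum_congr fun w => ?_
    by_cases h : w ∈ s <;> simp [h, hs]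
  rw [this, lintegral_sum_measure]
  refine tsum_congr fun w => ?_
  rw [lintegral_smul_measure, lintegral_dirac, smul_eq_mul]

/-- The Markov property at time `1`. -/
theorem law_shift (κ : W → PMF W) (w : W) {E : Set (ℕ → W)} (hE : MeasurableSet E) :
    law κ w {ω | (fun n => ω (n + 1)) ∈ E} = ∑' t, κ w t * law κ t E := by
  have hm : Measurable (fun (ω : ℕ → W) n => ω (n + 1)) :=
    measurable_pi_lambda _ fun _ => measurable_pi_apply _
  have hE' : MeasurableSet {ω : ℕ → W | (fun n => ω (n + 1)) ∈ E} := hm hE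
  have h0 := Kernel.traj_comp_partialTraj (X := fun _ => W) (κ := stepKernel κ) (zero_le_one' ℕ)
  have h1 : ∀ x, Kernel.traj (X := fun _ => W) (stepKernel κ) 1 x
      {ω : ℕ → W | (fun n => ω (n + 1)) ∈ E} = law κ (x ⟨1, Finset.mem_Iic.2 le_rfl⟩) E := by
    intro x
    rw [← traj_shift, Measure.map_apply hm hE]; rfl
  have h2 := Kernel.map_partialTraj_succ_self (X := fun _ => W) (κ := stepKernel κ) 0
  rw [law, ← h0, Kernel.comp_apply' _ _ _ hE', ← lintegral_toMeasure]
  simp only [h1]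
  have h3 : (κ w).toMeasure = stepKernel κ 0 (fun _ => w) := rfl
  rw [h3, ← h2, Kernel.map_apply _ (by fun_prop), lintegral_map .of_discrete (by fun_prop)]
  rfl

theorem law_zero (κ : W → PMF W) (w : W) : ∀ᵐ ω ∂law κ w, ω 0 = w := by
  have h := Kernel.traj_map_frestrictLe_apply (X := fun _ => W) (κ := stepKernel κ) 0 0 fun _ => w
  rw [Kernel.partialTraj_self, Kernel.id_apply] at h
  have h2 : ∀ᵐ y ∂(Measure.dirac fun _ : Finset.Iic 0 => w), y ⟨0, by simp⟩ = w := by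
    rw [ae_dirac_iff]
    exact (measurable_pi_apply (X := fun _ : Finset.Iic 0 => W) ⟨0, by simp⟩)
      (MeasurableSet.of_discrete (s := {w}))
  rw [← h] at h2
  exact ae_of_ae_map (by fun_prop) h2

end Trajectory

theorem tsum_mul_le (p : PMF W) {f : W → ℝ≥0∞} {c : ℝ≥0∞} (h : ∀ t, f t ≤ c) :
    ∑' t, p t * f t ≤ c := by
  calc ∑' t, p t * f t ≤ ∑' t, p t * c := ENNReal.tsum_le_tsum fun t => mul_le_mul_right (h t) _
    _ = c := by rw [ENNReal.tsum_mul_right, p.tsum_coe, one_mul]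

theorem tsum_map_mul {W' : Type*} (p : PMF W) (φ : W → W') (f : W' → ℝ≥0∞) :
    ∑' t, p.map φ t * f t = ∑' t, p t * f (φ t) := by
  classical
  simp only [PMF.map_apply, ← ENNReal.tsum_mul_right]
  rw [ENNReal.tsum_comm]
  refine tsum_congr fun a => ?_
  rw [tsum_eq_single (φ a)]
  · simp
  · intro b hb
    simp [hb]

/-! ### Hitting probabilities -/

/-- The set `K` of states cannot be left. -/
def IsClosed (κ : W → PMF W) (K : Set W) : Prop := ∀ w ∈ K, ∀ t ∈ (κ w).support, t ∈ K

open Classical in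
/-- The probability that the chain visits `D` within the first `k` steps. -/
noncomputable def hitWithin (κ : W → PMF W) (D : Set W) : ℕ → W → ℝ≥0∞
  | 0, w => if w ∈ D then 1 else 0
  | k + 1, w => if w ∈ D then 1 else ∑' t, κ w t * hitWithin κ D k t

/-- The probability that the chain visits `D`. -/
noncomputable def hitProb (κ : W → PMF W) (D : Set W) (w : W) : ℝ≥0∞ := ⨆ k, hitWithin κ D k w

theorem hitWithin_of_mem (κ : W → PMF W) {D : Set W} {w : W} (h : w ∈ D) (k : ℕ) :
    hitWithin κ D k w = 1 := by
  cases k <;> simp [hitWithin, h]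

theorem hitWithin_le_one (κ : W → PMF W) (D : Set W) (k : ℕ) (w : W) : hitWithin κ D k w ≤ 1 := by
  induction k generalizing w with
  | zero => rw [hitWithin]; split_ifs <;> simp
  | succ k ih =>
    rw [hitWithin]; split_ifs
    · exact le_rfl
    · exact tsum_mul_le _ ih

theorem hitWithin_mono (κ : W → PMF W) (D : Set W) : Monotone (hitWithin κ D) := by
  refine monotone_nat_of_le_succ fun k => ?_
  induction k with
  | zero =>
    intro w
    by_cases h : w ∈ D
    · simp [hitWithin_of_mem, h]
    · simp [hitWithin, h]
  | succ k ih =>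
    intro w
    by_cases h : w ∈ D
    · simp [hitWithin_of_mem, h]
    · rw [hitWithin, hitWithin, if_neg h, if_neg h]
      exact ENNReal.tsum_le_tsum fun t => mul_le_mul_right (ih t) _

theorem hitProb_le_one (κ : W → PMF W) (D : Set W) (w : W) : hitProb κ D w ≤ 1 :=
  iSup_le fun k => hitWithin_le_one κ D k w

theorem hitProb_of_mem (κ : W → PMF W) {D : Set W} {w : W} (h : w ∈ D) : hitProb κ D w = 1 := by
  simp [hitProb, hitWithin_of_mem κ h]

theorem tsum_hitProb_le (κ : W → PMF W) (D : Set W) (w : W) :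
    ∑' t, κ w t * hitProb κ D t ≤ hitProb κ D w := by
  by_cases h : w ∈ D
  · rw [hitProb_of_mem κ h]
    exact tsum_mul_le _ (hitProb_le_one κ D)
  let _ : MeasurableSpace W := ⊤
  have : DiscreteMeasurableSpace W := ⟨fun _ => trivial⟩
  rw [← lintegral_toMeasure]
  simp only [hitProb]
  rw [lintegral_iSup (fun _ => .of_discrete) (hitWithin_mono κ D)]
  refine iSup_le fun k => le_iSup_of_le (k + 1) ?_
  rw [lintegral_toMeasure, hitWithin, if_neg h]

/-- A function that is superharmonic on a closed set `K` and at least `c` on `D` is at least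
`c` times the probability of a visit to `D`. -/
theorem mul_hitProb_le {κ : W → PMF W} {K D : Set W} (hK : IsClosed κ K) {e : W → ℝ≥0∞}
    {c : ℝ≥0∞} (he : ∀ w ∈ K, ∑' t, κ w t * e t ≤ e w) (hD : ∀ w ∈ K, w ∈ D → c ≤ e w)
    {w : W} (hw : w ∈ K) : c * hitProb κ D w ≤ e w := by
  rw [hitProb, ENNReal.mul_iSup]
  refine iSup_le fun k => ?_
  induction k generalizing w with
  | zero =>
    by_cases h : w ∈ D
    · simpa [hitWithin_of_mem κ h] using hD w hw h
    · simp [hitWithin, h]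
  | succ k ih =>
    by_cases h : w ∈ D
    · simpa [hitWithin_of_mem κ h] using hD w hw h
    · rw [hitWithin, if_neg h, ← ENNReal.tsum_mul_left]
      refine le_trans (ENNReal.tsum_le_tsum fun t => ?_) (he w hw)
      by_cases ht : κ w t = 0
      · simp [ht]
      · rw [mul_left_comm]
        exact mul_le_mul_right (ih (hK w hw t (((κ w).mem_support_iff t).2 ht))) _

/-- A superharmonic function that is at least `c` on a closed set `K` exceeds `c` by a fixed
proportion of `d` at every state with a path to a state where it is at least `c + d`. For the
probability of a visit to `v`, `c = 0` and `d = 1`, this says that a state `v` that is reachable in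
the graph of the chain is visited with positive probability. -/
theorem exists_gain {κ : W → PMF W} {K : Set W} (hK : IsClosed κ K) {e : W → ℝ≥0∞}
    {c d : ℝ≥0∞} (he : ∀ w ∈ K, ∑' t, κ w t * e t ≤ e w) (hc : ∀ w ∈ K, c ≤ e w) {w v : W}
    (h : Relation.ReflTransGen (fun w t => t ∈ (κ w).support) w v) (hw : w ∈ K)
    (hv : c + d ≤ e v) : ∃ p, 0 < p ∧ c + p * d ≤ e w := by
  induction h using Relation.ReflTransGen.head_induction_on with
  | refl => exact ⟨1, one_pos, by simpa using hv⟩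
  | @head w t hwt _ ih =>
    have htK := hK w hw t hwt
    obtain ⟨p, hp, hpt⟩ := ih htK
    have hpos : κ w t ≠ 0 := ((κ w).mem_support_iff t).1 hwt
    classical
    refine ⟨κ w t * p, pos_iff_ne_zero.2 (mul_ne_zero hpos hp.ne'), le_trans ?_ (he w hw)⟩
    calc c + κ w t * p * d
        = ∑' s, (κ w s * c + if s = t then κ w t * p * d else 0) := by
          rw [ENNReal.tsum_add, ENNReal.tsum_mul_right, (κ w).tsum_coe, one_mul, tsum_ite_eq]
      _ ≤ ∑' s, κ w s * e s := ENNReal.tsum_le_tsum fun s => by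
          by_cases hs : κ w s = 0
          · have : s ≠ t := fun h => hpos (h ▸ hs)
            simp [hs, this]
          · by_cases hst : s = t
            · subst hst
              rw [if_pos rfl, mul_assoc, ← mul_add]
              exact mul_le_mul_right hpt _
            · rw [if_neg hst, add_zero]
              exact mul_le_mul_right (hc s (hK w hw s (((κ w).mem_support_iff s).2 hs))) _

/-- In a closed set `K` from which a finite set `A` is visited almost surely, every set `D` that
is reachable from all states of `K` is visited almost surely. -/
theorem hitProb_eq_one {κ : W → PMF W} {K A D : Set W} (hK : IsClosed κ K) (hA : A.Finite)
    (hAK : ∀ w ∈ K, hitProb κ A w = 1)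
    (hD : ∀ w ∈ K, ∃ v ∈ D, Relation.ReflTransGen (fun w t => t ∈ (κ w).support) w v)
    {w : W} (hw : w ∈ K) : hitProb κ D w = 1 := by
  -- the least probability `c` of a visit to `D` cannot be smaller than `1`, since it is at least
  -- `c + p * (1 - c)` on the finite set `A`, hence everywhere, for some `p > 0`
  set c : ℝ≥0∞ := ⨅ v ∈ K, hitProb κ D v
  have hc : ∀ v ∈ K, c ≤ hitProb κ D v := fun v hv => iInf₂_le v hv
  have hc1 : c ≤ 1 := (hc w hw).trans (hitProb_le_one _ _ _)
  have hcd : c + (1 - c) = 1 := add_tsub_cancel_of_le hc1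
  have hsup := fun (v : W) (_ : v ∈ K) => tsum_hitProb_le κ D v
  have hgain : ∀ a ∈ A, ∃ p, 0 < p ∧ (a ∈ K → c + p * (1 - c) ≤ hitProb κ D a) := by
    intro a _
    by_cases ha : a ∈ K
    · obtain ⟨v, hv, hav⟩ := hD a ha
      obtain ⟨p, hp, h⟩ := exists_gain hK hsup hc (d := 1 - c) hav ha
        (by rw [hcd, hitProb_of_mem κ hv])
      exact ⟨p, hp, fun _ => h⟩
    · exact ⟨1, one_pos, fun h => absurd h ha⟩
  choose! p hp hpA using hgain
  obtain ⟨q, hq, hqA⟩ : ∃ q, 0 < q ∧ ∀ a ∈ A, q ≤ p a := by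
    rcases A.eq_empty_or_nonempty with rfl | hne
    · exact ⟨1, one_pos, by simp⟩
    · obtain ⟨a, ha, h⟩ := hA.exists_minimalFor p A hne
      exact ⟨p a, hp a ha, fun b hb => (le_total (p a) (p b)).elim id fun hba => h hb hba⟩
  have hall : ∀ v ∈ K, c + q * (1 - c) ≤ hitProb κ D v := by
    intro v hv
    have := mul_hitProb_le (D := A) hK hsup (c := c + q * (1 - c)) (fun a haK haA =>
      le_trans (by gcongr; exact hqA a haA) (hpA a haA haK)) hv
    rwa [hAK v hv, mul_one] at this
  have hle : c + q * (1 - c) ≤ c := le_iInf₂ hall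
  have h0 : q * (1 - c) = 0 := by
    have hfin : c ≠ ⊤ := ne_top_of_le_ne_top ENNReal.one_ne_top hc1
    have : c + q * (1 - c) ≤ c + 0 := by simpa using hle
    exact le_antisymm ((ENNReal.add_le_add_iff_left hfin).1 this) (zero_le)
  have h1 : 1 - c = 0 := (mul_eq_zero.1 h0).resolve_left hq.ne'
  exact le_antisymm (hitProb_le_one _ _ _) ((tsub_eq_zero_iff_le.1 h1).trans (hc w hw))

/-- Hitting probabilities are preserved by maps between chains. -/
theorem hitProb_map {W' : Type*} {κ : W → PMF W} {κ' : W' → PMF W'} {φ : W → W'} {K : Set W}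
    (hK : IsClosed κ K) (hφ : ∀ w ∈ K, (κ w).map φ = κ' (φ w)) (D : Set W') {w : W} (hw : w ∈ K) :
    hitProb κ (φ ⁻¹' D) w = hitProb κ' D (φ w) := by
  refine iSup_congr fun k => ?_
  induction k generalizing w with
  | zero => simp only [hitWithin, Set.mem_preimage]; rfl
  | succ k ih =>
    simp only [hitWithin, Set.mem_preimage]
    congr 1
    rw [← hφ w hw, tsum_map_mul]
    refine tsum_congr fun t => ?_
    by_cases ht : κ w t = 0
    · simp [ht]
    · rw [ih (hK w hw t (((κ w).mem_support_iff t).2 ht))]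

/-! ### Almost sure properties of the runs of a chain -/

section Law

variable [MeasurableSpace W] [DiscreteMeasurableSpace W]

theorem measurableSet_exists_le (D : Set W) (k : ℕ) :
    MeasurableSet {ω : ℕ → W | ∃ j ≤ k, ω j ∈ D} := by
  have : {ω : ℕ → W | ∃ j ≤ k, ω j ∈ D} = ⋃ j ≤ k, (fun ω => ω j) ⁻¹' D := by ext; simp
  rw [this]
  exact .iUnion fun j => .iUnion fun _ => measurable_pi_apply j .of_discrete

theorem law_hitWithin (κ : W → PMF W) (D : Set W) (k : ℕ) (w : W) :
    law κ w {ω | ∃ j ≤ k, ω j ∈ D} = hitWithin κ D k w := by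
  induction k generalizing w with
  | zero =>
    rw [hitWithin]
    split_ifs with h
    · rw [← mem_ae_iff_prob_eq_one (measurableSet_exists_le D 0)]
      filter_upwards [law_zero κ w] with ω hω using ⟨0, le_rfl, by rwa [hω]⟩
    · rw [measure_eq_zero_iff_ae_notMem]
      filter_upwards [law_zero κ w] with ω hω ⟨j, hj, hjD⟩
      rw [Nat.le_zero.1 hj, hω] at hjD
      exact h hjD
  | succ k ih =>
    rw [hitWithin]
    split_ifs with h
    · rw [← mem_ae_iff_prob_eq_one (measurableSet_exists_le D _)]
      filter_upwards [law_zero κ w] with ω hω using ⟨0, Nat.zero_le _, by rwa [hω]⟩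
    · simp only [← ih]
      rw [← law_shift κ w (measurableSet_exists_le D k)]
      refine measure_congr ?_
      filter_upwards [law_zero κ w] with ω hω
      refine propext ⟨?_, ?_⟩
      · rintro ⟨j, hj, hjD⟩
        cases j with
        | zero => rw [hω] at hjD; exact absurd hjD h
        | succ j => exact ⟨j, Nat.le_of_succ_le_succ hj, hjD⟩
      · rintro ⟨j, hj, hjD⟩
        exact ⟨j + 1, Nat.succ_le_succ hj, hjD⟩

theorem law_hit (κ : W → PMF W) (D : Set W) (w : W) :
    law κ w {ω | ∃ j, ω j ∈ D} = hitProb κ D w := by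
  have : {ω : ℕ → W | ∃ j, ω j ∈ D} = ⋃ k, {ω | ∃ j ≤ k, ω j ∈ D} := by
    ext ω
    simp only [Set.mem_iUnion]
    exact ⟨fun ⟨j, hj⟩ => ⟨j, j, le_rfl, hj⟩, fun ⟨_, j, _, hj⟩ => ⟨j, hj⟩⟩
  rw [this, Monotone.measure_iUnion, hitProb]
  · simp only [law_hitWithin]
  · exact fun a b hab ω ⟨j, hj, h⟩ => ⟨j, hj.trans hab, h⟩

theorem ae_shift {κ : W → PMF W} {w : W} {E : Set (ℕ → W)} (hE : MeasurableSet E)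
    (h : ∀ t ∈ (κ w).support, ∀ᵐ ω ∂law κ t, ω ∈ E) :
    ∀ᵐ ω ∂law κ w, (fun n => ω (n + 1)) ∈ E := by
  change law κ w {ω | (fun n => ω (n + 1)) ∈ Eᶜ} = 0
  rw [law_shift κ w hE.compl, ENNReal.tsum_eq_zero]
  intro t
  by_cases ht : κ w t = 0
  · simp [ht]
  · rw [show law κ t Eᶜ = 0 from h t (((κ w).mem_support_iff t).2 ht), mul_zero]

/-- If a property of the run holds almost surely from all states of a closed set, then almost
surely it holds for all suffixes of the run. -/
theorem ae_forall_shift {κ : W → PMF W} {K : Set W} (hK : IsClosed κ K) {E : Set (ℕ → W)}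
    (hE : MeasurableSet E) (h : ∀ w ∈ K, ∀ᵐ ω ∂law κ w, ω ∈ E) {w : W} (hw : w ∈ K) :
    ∀ᵐ ω ∂law κ w, ∀ k, (fun n => ω (n + k)) ∈ E := by
  rw [ae_all_iff]
  intro k
  induction k generalizing w with
  | zero => exact h w hw
  | succ k ih =>
    have hm : Measurable (fun (ω : ℕ → W) n => ω (n + k)) :=
      measurable_pi_lambda _ fun _ => measurable_pi_apply _
    filter_upwards [ae_shift (hm hE) fun t ht => ih (hK w hw t ht)] with ω hω
    simpa [Set.mem_preimage, add_assoc] using hω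

theorem ae_forall_mem {κ : W → PMF W} {K : Set W} (hK : IsClosed κ K) {w : W} (hw : w ∈ K) :
    ∀ᵐ ω ∂law κ w, ∀ k, ω k ∈ K := by
  have hE : MeasurableSet {ω : ℕ → W | ω 0 ∈ K} := measurable_pi_apply 0 .of_discrete
  filter_upwards [ae_forall_shift hK hE (fun v hv => by
    filter_upwards [law_zero κ v] with ω hω
    rwa [hω]) hw] with ω hω k
  simpa using hω k

theorem ae_frequently {κ : W → PMF W} {K D : Set W} (hK : IsClosed κ K)
    (hD : ∀ w ∈ K, hitProb κ D w = 1) {w : W} (hw : w ∈ K) :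
    ∀ᵐ ω ∂law κ w, ∃ᶠ k in atTop, ω k ∈ D := by
  have hE : MeasurableSet {ω : ℕ → W | ∃ j, ω j ∈ D} := by
    have : {ω : ℕ → W | ∃ j, ω j ∈ D} = ⋃ j, (fun ω => ω j) ⁻¹' D := by ext; simp
    rw [this]
    exact .iUnion fun j => measurable_pi_apply j .of_discrete
  filter_upwards [ae_forall_shift hK hE (fun v hv =>
    (mem_ae_iff_prob_eq_one hE).2 (by rw [law_hit, hD v hv])) hw] with ω hω
  rw [frequently_atTop]
  intro k
  obtain ⟨j, hj⟩ := hω k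
  exact ⟨j + k, Nat.le_add_left _ _, hj⟩

end Law

end MarkovChain

/-! ### Bottom states of a graph -/

section Graph

open Relation

variable {W : Type*}

/-- Every state that is reachable from `b` lies in the strongly connected component of `b`. -/
def IsBottom (r : W → W → Prop) (b : W) : Prop :=
  ∀ c, ReflTransGen r b c → ReflTransGen r c b

/-- The largest color that is reachable from `b` is `≡ y` modulo `2`. -/
def IsDominated (r : W → W → Prop) (col : W → ℕ) (y : Player) (b : W) : Prop :=
  ∃ i, Player.ofNat i = y ∧ (∃ c, ReflTransGen r b c ∧ col c = i) ∧
    ∀ c, ReflTransGen r b c → col c ≤ i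

theorem IsDominated.of_reach {r : W → W → Prop} {col : W → ℕ} {y : Player} {b c : W}
    (hb : IsBottom r b) (h : ReflTransGen r b c) (hc : IsDominated r col y c) :
    IsDominated r col y b := by
  obtain ⟨i, hi, ⟨d, hd, hdi⟩, hle⟩ := hc
  exact ⟨i, hi, ⟨d, h.trans hd, hdi⟩, fun e he => hle e ((hb c h).trans he)⟩

/-- If a finite set is reachable from all states that are reachable from `w`, then some bottom
state is reachable from `w`. -/
theorem exists_isBottom {r : W → W → Prop} {A : Set W} (hA : A.Finite) {w : W}
    (h : ∀ v, ReflTransGen r w v → ∃ a ∈ A, ReflTransGen r v a) :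
    ∃ b, ReflTransGen r w b ∧ IsBottom r b := by
  -- a state of `A` from which as few states of `A` as possible are reachable is a bottom state
  let B : Set W := {a ∈ A | ReflTransGen r w a}
  have hB : B.Finite := hA.subset fun a ha => ha.1
  have hne : B.Nonempty := by
    obtain ⟨a, ha, hwa⟩ := h w .refl
    exact ⟨a, ha, hwa⟩
  obtain ⟨b, hb, hmin⟩ := hB.exists_minimalFor (fun a => {c ∈ A | ReflTransGen r a c}) B hne
  refine ⟨b, hb.2, fun c hc => ?_⟩
  obtain ⟨a, ha, hca⟩ := h c (hb.2.trans hc)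
  have hba := hc.trans hca
  have := hmin (j := a) ⟨ha, hb.2.trans hba⟩ fun d hd => ⟨hd.1, hba.trans hd.2⟩
  exact hca.trans (this ⟨hb.1, .refl⟩).2

/-- Two relations that agree on a set which is closed under the first one. -/
structure AgreeOn (r r' : W → W → Prop) (K : Set W) : Prop where
  closed : ∀ w ∈ K, ∀ v, r w v → v ∈ K
  iff : ∀ w ∈ K, ∀ v, r w v ↔ r' w v

namespace AgreeOn

variable {r r' : W → W → Prop} {K : Set W}

theorem mem (h : AgreeOn r r' K) {w v : W} (hw : w ∈ K) (hv : ReflTransGen r w v) : v ∈ K := by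
  induction hv with
  | refl => exact hw
  | tail _ hr ih => exact h.closed _ ih _ hr

theorem reach_iff (h : AgreeOn r r' K) {w v : W} (hw : w ∈ K) :
    ReflTransGen r w v ↔ ReflTransGen r' w v := by
  constructor
  · intro hv
    induction hv with
    | refl => exact .refl
    | tail hu hr ih => exact ih.tail ((h.iff _ (h.mem hw hu) _).1 hr)
  · intro hv
    induction hv with
    | refl => exact .refl
    | tail _ hr ih => exact ih.tail ((h.iff _ (h.mem hw ih) _).2 hr)

theorem isBottom_iff (h : AgreeOn r r' K) {b : W} (hb : b ∈ K) : IsBottom r b ↔ IsBottom r' b := by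
  refine forall_congr' fun c => ?_
  rw [← h.reach_iff hb]
  exact imp_congr_right fun hc => h.reach_iff (h.mem hb hc)

theorem isDominated_iff (h : AgreeOn r r' K) {col : W → ℕ} {y : Player} {b : W} (hb : b ∈ K) :
    IsDominated r col y b ↔ IsDominated r' col y b := by
  simp only [IsDominated, h.reach_iff hb]

end AgreeOn

end Graph

theorem Player.one_sub_one_sub : ∀ x : Player, 1 - (1 - x) = x := by decide

theorem Player.one_sub_ne : ∀ x : Player, 1 - x ≠ x := by decide

theorem Player.owner_trichotomy : ∀ (o : Option Player) (x : Player),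
    o = none ∨ o = some x ∨ o = some (1 - x) := by
  decide

theorem Player.ofNat_succ (n : ℕ) : Player.ofNat n = 1 - Player.ofNat (n + 1) := by
  rcases Nat.mod_two_eq_zero_or_one n with h | h
  · have h' : (n + 1) % 2 = 1 := by omega
    simp [Player.ofNat, h, h']
  · have h' : (n + 1) % 2 = 0 := by omega
    simp [Player.ofNat, h, h']

namespace StochasticGame

open Relation

variable {V : Type u}

/-! ### Sub-games -/

/-- `G'` is the restriction of `G` to a set of states. -/
structure IsSubgame (G' G : StochasticGame V) : Prop where
  subset : G'.states ⊆ G.states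
  owner : G'.owner = G.owner
  col : G'.col = G.col
  trans_iff : ∀ s t, G'.trans s t ↔ G.trans s t ∧ s ∈ G'.states ∧ t ∈ G'.states

theorem IsSubgame.trans {G₁ G₂ G₃ : StochasticGame V} (h : G₁.IsSubgame G₂) (h' : G₂.IsSubgame G₃) :
    G₁.IsSubgame G₃ where
  subset := h.subset.trans h'.subset
  owner := h.owner.trans h'.owner
  col := h.col.trans h'.col
  trans_iff s t := by
    rw [h.trans_iff, h'.trans_iff]
    exact ⟨fun H => ⟨H.1.1, H.2⟩, fun H => ⟨⟨H.1, h.subset H.2.1, h.subset H.2.2⟩, H.2⟩⟩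

theorem isSubgame_subForce (G : StochasticGame V) (x : Player) (T : Set V) :
    (G.subForce x T).IsSubgame G where
  subset _ h := h.1
  owner := rfl
  col := rfl
  trans_iff _ _ := Iff.rfl

/-- The qualitative form of being an attractor: the set meets all nonempty closable sets. -/
def MeetsClosable (G : StochasticGame V) (A : Set V) : Prop :=
  ∀ Q ⊆ G.states, Q.Nonempty → G.Closable Q → (Q ∩ A).Nonempty

theorem MeetsClosable.of_isSubgame {G' G : StochasticGame V} {A : Set V} (hA : G.MeetsClosable A)
    (h : G'.IsSubgame G)
    (hr : ∀ s ∈ G'.states, G.owner s = none → ∀ t, G.trans s t → t ∈ G'.states) :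
    G'.MeetsClosable A := by
  refine fun Q hQ hne hc => hA Q (hQ.trans h.subset) hne ⟨fun s hs => ?_, fun s hs ho t hst => ?_⟩
  · obtain ⟨t, ht, hst⟩ := hc.1 s hs
    exact ⟨t, ht, ((h.trans_iff s t).1 hst).1⟩
  · exact hc.2 s hs (h.owner ▸ ho) t ((h.trans_iff s t).2 ⟨hst, hQ hs, hr s (hQ hs) ho t hst⟩)

/-- From the complement of `Force^x`, only Player `1 - x` can move into `Force^x`. -/
theorem trans_subForce (G : StochasticGame V) (x : Player) (T : Set V) {s t : V}
    (hs : s ∈ (G.subForce x T).states) (ho : G.owner s = none ∨ G.owner s = some x)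
    (hst : G.trans s t) : t ∈ (G.subForce x T).states := by
  obtain ⟨γ, h1, h2⟩ := G.force_fixed x T
  refine ⟨(G.trans_mem hst).2, fun ht => hs.2 ?_⟩
  rw [h1] at ht ⊢
  rw [h2, reach_succ]
  rcases ho with ho | ho
  · exact Or.inl (Or.inl (Or.inr ⟨⟨t, ht, hst⟩, ho⟩))
  · exact Or.inl (Or.inr ⟨⟨t, ht, hst⟩, ho⟩)

theorem MeetsClosable.subForce {G : StochasticGame V} {A : Set V} (hA : G.MeetsClosable A)
    (x : Player) (T : Set V) : (G.subForce x T).MeetsClosable A :=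
  hA.of_isSubgame (G.isSubgame_subForce x T) fun _ hs ho _ hst =>
    G.trans_subForce x T hs (Or.inl ho) hst

theorem HasRank.subForce {G : StochasticGame V} {n : ℕ} (hG : G.HasRank n) (x : Player)
    (T : Set V) : (G.subForce x T).HasRank n :=
  fun s hs => hG s hs.1

/-! ### Force sets -/

theorem subset_force (G : StochasticGame V) (x : Player) (T : Set V) : T ⊆ G.force x T := by
  have h0 : G.reach x T 0 = T := by simp [reach]
  conv_lhs => rw [← h0]
  exact G.reach_mono x T (zero_le)

theorem reach_limit (G : StochasticGame V) (x : Player) (T : Set V) {α : Ordinal.{u}}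
    (hα : Order.IsSuccLimit α) : G.reach x T α = ⋃ β : Set.Iio α, G.reach x T β.1 := by
  simp only [reach]
  rw [Ordinal.limitRecOn_limit _ _ _ _ hα]

/-- The rank of a state of a force set: Player `x` and the random states can decrease it, and
Player `1 - x` has to decrease it, until `T` is reached. -/
theorem exists_rank (G : StochasticGame V) (x : Player) (T : Set V) :
    ∃ ρ : V → Ordinal.{u}, ∀ s ∈ G.force x T, s ∉ T → s ∈ G.states ∧
      (G.owner s = none ∨ G.owner s = some x →
        ∃ t ∈ G.force x T, G.trans s t ∧ ρ t < ρ s) ∧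
      (G.owner s = some (1 - x) → ∀ t, G.trans s t → t ∈ G.force x T ∧ ρ t < ρ s) := by
  obtain ⟨γ, h1, -⟩ := G.force_fixed x T
  have hsub : ∀ α, α ≤ γ → G.reach x T α ⊆ G.force x T := fun α h => h1 ▸ G.reach_mono x T h
  let ρ : V → Ordinal.{u} := fun s => sInf {α | s ∈ G.reach x T α}
  have hρle : ∀ {s α}, s ∈ G.reach x T α → ρ s ≤ α := fun h => csInf_le' h
  refine ⟨ρ, fun s hs hsT => ?_⟩
  have hmem : s ∈ G.reach x T (ρ s) :=
    csInf_mem (s := {α | s ∈ G.reach x T α}) ⟨γ, by rwa [h1] at hs⟩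
  have hργ : ρ s ≤ γ := hρle (by rwa [h1] at hs)
  -- the rank of a state outside `T` is a successor ordinal
  obtain ⟨α, hα⟩ : ∃ α, ρ s = α + 1 := by
    rcases Ordinal.zero_or_succ_or_isSuccLimit (ρ s) with h | ⟨α, h⟩ | h
    · rw [h] at hmem
      exact absurd (by simpa [reach] using hmem) hsT
    · exact ⟨α, by simpa using h.symm⟩
    · rw [G.reach_limit x T h] at hmem
      obtain ⟨⟨β, hβ⟩, hsβ⟩ := Set.mem_iUnion.1 hmem
      exact absurd (hρle hsβ) (not_le.2 hβ)
  have hαlt : α < ρ s := by rw [hα]; exact Order.lt_add_one_iff.2 le_rfl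
  have hnot : s ∉ G.reach x T α := fun h => absurd (hρle h) (not_le.2 hαlt)
  have hstep : ∀ t ∈ G.reach x T α, t ∈ G.force x T ∧ ρ t < ρ s := fun t ht =>
    ⟨hsub α (hαlt.le.trans hργ) ht, (hρle ht).trans_lt hαlt⟩
  rw [hα, reach_succ] at hmem
  have hx : (1 - x : Player) ≠ x := Player.one_sub_ne x
  rcases hmem with ((h | ⟨⟨t, ht, hst⟩, ho⟩) | ⟨⟨t, ht, hst⟩, ho⟩) | ⟨⟨hsG, hd⟩, ho⟩
  · exact absurd h hnot
  · refine ⟨(G.trans_mem hst).1, fun _ => ⟨t, (hstep t ht).1, hst, (hstep t ht).2⟩, fun h => ?_⟩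
    rw [Set.mem_ofPred_eq] at ho
    simp [ho] at h
  · refine ⟨(G.trans_mem hst).1, fun _ => ⟨t, (hstep t ht).1, hst, (hstep t ht).2⟩, fun h => ?_⟩
    rw [Set.mem_ofPred_eq] at ho
    rw [ho, Option.some_inj] at h
    exact absurd h.symm hx
  · rw [Set.mem_ofPred_eq] at ho
    refine ⟨hsG, fun h => ?_, fun _ t hst => hstep t ?_⟩
    · rw [ho, Option.some_inj] at h
      rcases h with h | h
      · cases h
      · exact absurd h hx
    · by_contra hcon
      exact hd ⟨t, ⟨(G.trans_mem hst).2, hcon⟩, hst⟩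

/-! ### The graph of a memoryless strategy and a memory structure -/

/-- `F` chooses a successor of every state of Player `x`. -/
def IsLegal (G : StochasticGame V) (x : Player) (F : V → V) : Prop :=
  ∀ s ∈ G.states, G.owner s = some x → G.trans s (F s)

variable {G : StochasticGame V} {x : Player} {M : Type}

/-- The possible steps from one pair of a state and a memory configuration to another one, if
Player `x` uses the memoryless strategy `F` and Player `1 - x` uses the memory structure `𝓜`. -/
def Edge (G : StochasticGame V) (x : Player) (F : V → V) (𝓜 : G.MemoryStructure (1 - x) M)
    (w v : V × M) : Prop :=
  (G.owner w.1 = none → G.trans w.1 v.1) ∧ (G.owner w.1 = some x → v.1 = F w.1) ∧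
    (G.owner w.1 = some (1 - x) → v.1 = 𝓜.next w.1 w.2) ∧ v.2 = 𝓜.update w.1 w.2

theorem Edge.trans {F : V → V} (hF : G.IsLegal x F) {𝓜 : G.MemoryStructure (1 - x) M}
    {w v : V × M} (h : G.Edge x F 𝓜 w v) (hw : w.1 ∈ G.states) : G.trans w.1 v.1 := by
  rcases Player.owner_trichotomy (G.owner w.1) x with ho | ho | ho
  · exact h.1 ho
  · rw [h.2.1 ho]; exact hF _ hw ho
  · rw [h.2.2.1 ho]; exact 𝓜.legal _ hw ho _

theorem edge_random {F : V → V} {𝓜 : G.MemoryStructure (1 - x) M} {s t : V} (m : M)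
    (ho : G.owner s = none) (h : G.trans s t) :
    G.Edge x F 𝓜 (s, m) (t, 𝓜.update s m) :=
  ⟨fun _ => h, fun h => by simp [ho] at h, fun h => by simp [ho] at h, rfl⟩

theorem edge_self {F : V → V} {𝓜 : G.MemoryStructure (1 - x) M} {s : V} (m : M)
    (ho : G.owner s = some x) : G.Edge x F 𝓜 (s, m) (F s, 𝓜.update s m) := by
  refine ⟨fun h => ?_, fun _ => rfl, fun h => ?_, rfl⟩
  · simp [ho] at h
  · rw [ho, Option.some_inj] at h
    exact absurd h.symm (Player.one_sub_ne x)

theorem edge_opponent {F : V → V} {𝓜 : G.MemoryStructure (1 - x) M} {s : V} (m : M)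
    (ho : G.owner s = some (1 - x)) :
    G.Edge x F 𝓜 (s, m) (𝓜.next s m, 𝓜.update s m) := by
  refine ⟨fun h => ?_, fun h => ?_, fun _ => rfl, rfl⟩
  · simp [ho] at h
  · rw [ho, Option.some_inj] at h
    exact absurd h (Player.one_sub_ne x)

theorem reach_mem_states {F : V → V} (hF : G.IsLegal x F) {𝓜 : G.MemoryStructure (1 - x) M}
    {w v : V × M} (h : ReflTransGen (G.Edge x F 𝓜) w v) (hw : w.1 ∈ G.states) :
    v.1 ∈ G.states := by
  induction h with
  | refl => exact hw
  | tail _ he ih => exact (G.trans_mem (he.trans hF ih)).2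

theorem exists_edge {F : V → V} (𝓜 : G.MemoryStructure (1 - x) M) {w : V × M}
    (hw : w.1 ∈ G.states) : ∃ v, G.Edge x F 𝓜 w v := by
  rcases Player.owner_trichotomy (G.owner w.1) x with ho | ho | ho
  · obtain ⟨t, ht⟩ := G.exists_succ _ hw
    exact ⟨_, edge_random w.2 ho ht⟩
  · exact ⟨_, edge_self w.2 ho⟩
  · exact ⟨_, edge_opponent w.2 ho⟩

/-- A set that meets all closable sets is reachable from every state. -/
theorem MeetsClosable.reachable {A : Set V} (hA : G.MeetsClosable A) {F : V → V}
    (hF : G.IsLegal x F) (𝓜 : G.MemoryStructure (1 - x) M) {w : V × M} (hw : w.1 ∈ G.states) :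
    ∃ v, v.1 ∈ A ∧ ReflTransGen (G.Edge x F 𝓜) w v := by
  -- the states that are reachable from `w` form a closable set
  obtain ⟨t, ⟨m, hm⟩, htA⟩ := hA {t | ∃ m, ReflTransGen (G.Edge x F 𝓜) w (t, m)}
    (fun t ⟨m, hm⟩ => reach_mem_states hF hm hw) ⟨w.1, w.2, .refl⟩
    ⟨fun s ⟨m, hm⟩ => by
      have hs := reach_mem_states hF hm hw
      obtain ⟨v, hv⟩ := exists_edge (F := F) 𝓜 hs
      exact ⟨v.1, ⟨v.2, hm.tail hv⟩, hv.trans hF hs⟩,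
    fun s ⟨m, hm⟩ ho t hst => ⟨_, hm.tail (edge_random m ho hst)⟩⟩
  exact ⟨(t, m), htA, hm⟩

theorem exists_reachable_isBottom {A : Set V} (hfin : A.Finite) (hA : G.MeetsClosable A)
    [Finite M] {F : V → V} (hF : G.IsLegal x F) (𝓜 : G.MemoryStructure (1 - x) M) {w : V × M}
    (hw : w.1 ∈ G.states) :
    ∃ b, ReflTransGen (G.Edge x F 𝓜) w b ∧ IsBottom (G.Edge x F 𝓜) b := by
  refine exists_isBottom (A := A ×ˢ Set.univ) (hfin.prod Set.finite_univ) fun v hv => ?_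
  obtain ⟨a, ha, h⟩ := hA.reachable hF 𝓜 (reach_mem_states hF hv hw)
  exact ⟨a, ⟨ha, trivial⟩, h⟩

/-- If `F` decreases the rank of the states of Player `x` in a force set, then the target is
reachable against every memory structure of the opponent. -/
theorem force_reachable {T : Set V} {ρ : V → Ordinal.{u}} (hρ : ∀ s ∈ G.force x T, s ∉ T →
      s ∈ G.states ∧
      (G.owner s = none ∨ G.owner s = some x → ∃ t ∈ G.force x T, G.trans s t ∧ ρ t < ρ s) ∧
      (G.owner s = some (1 - x) → ∀ t, G.trans s t → t ∈ G.force x T ∧ ρ t < ρ s))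
    {F : V → V} (hF : ∀ s ∈ G.force x T, s ∉ T → G.owner s = some x →
      F s ∈ G.force x T ∧ ρ (F s) < ρ s)
    (𝓜 : G.MemoryStructure (1 - x) M) {s : V} (hs : s ∈ G.force x T) (m : M) :
    ∃ v, v.1 ∈ T ∧ ReflTransGen (G.Edge x F 𝓜) (s, m) v := by
  induction hα : ρ s using WellFoundedLT.induction generalizing s m with
  | ind α ih =>
    subst hα
    by_cases hsT : s ∈ T
    · exact ⟨_, hsT, .refl⟩
    have key : ∀ t, t ∈ G.force x T → ρ t < ρ s → G.Edge x F 𝓜 (s, m) (t, 𝓜.update s m) →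
        ∃ v, v.1 ∈ T ∧ ReflTransGen (G.Edge x F 𝓜) (s, m) v := fun t ht hlt he => by
      obtain ⟨v, hv, h⟩ := ih (ρ t) hlt ht (𝓜.update s m) rfl
      exact ⟨v, hv, h.head he⟩
    obtain ⟨hsG, h1, h2⟩ := hρ s hs hsT
    rcases Player.owner_trichotomy (G.owner s) x with ho | ho | ho
    · obtain ⟨t, ht, hst, hlt⟩ := h1 (Or.inl ho)
      exact key t ht hlt (edge_random m ho hst)
    · exact key _ (hF s hs hsT ho).1 (hF s hs hsT ho).2 (edge_self m ho)
    · have := h2 ho _ (𝓜.legal s hsG ho m)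
      exact key _ this.1 this.2 (edge_opponent m ho)

/-- The qualitative form of winning with positive probability: from `s` and against every finite
memory structure, a bottom state is reachable whose largest reachable color is `≡ x`. -/
def WinsPos (G : StochasticGame V) (x : Player) (F : V → V) (s : V) : Prop :=
  ∀ (M : Type) [Finite M] (𝓜 : G.MemoryStructure (1 - x) M) (m : M),
    ∃ b, ReflTransGen (G.Edge x F 𝓜) (s, m) b ∧ IsBottom (G.Edge x F 𝓜) b ∧
      IsDominated (G.Edge x F 𝓜) (fun w => G.col w.1) x b

/-- The qualitative form of winning almost surely: against every finite memory structure, all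
bottom states that are reachable from `s` have a largest reachable color `≡ x`. -/
def WinsAS (G : StochasticGame V) (x : Player) (F : V → V) (s : V) : Prop :=
  ∀ (M : Type) [Finite M] (𝓜 : G.MemoryStructure (1 - x) M) (m : M) (b : V × M),
    ReflTransGen (G.Edge x F 𝓜) (s, m) b → IsBottom (G.Edge x F 𝓜) b →
      IsDominated (G.Edge x F 𝓜) (fun w => G.col w.1) x b

/-! ### Passing to a sub-game -/

open Classical in
/-- The memory structure that plays like `𝓜` as long as this does not leave the sub-game `G'`. -/
noncomputable def MemoryStructure.restrict {y : Player} (𝓜 : G.MemoryStructure y M)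
    (G' : StochasticGame V) : G'.MemoryStructure y M where
  init := 𝓜.init
  next s m := if G'.trans s (𝓜.next s m) then 𝓜.next s m else
    if h : s ∈ G'.states then (G'.exists_succ s h).choose else s
  update := 𝓜.update
  legal s hs _ m := by
    split_ifs with h
    · exact h
    · exact (G'.exists_succ s hs).choose_spec

/-- On a closed set of pairs whose states belong to the sub-game, a memory structure and its
restriction produce the same graph. -/
theorem agreeOn_restrict {G' : StochasticGame V} (h : G'.IsSubgame G) {F F' : V → V}
    (𝓜 : G.MemoryStructure (1 - x) M) {K : Set (V × M)} (hF : ∀ w ∈ K, G.owner w.1 = some x →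
      F w.1 = F' w.1) (hK : ∀ w ∈ K, w.1 ∈ G'.states)
    (hcl : ∀ w ∈ K, ∀ v, G.Edge x F 𝓜 w v → v ∈ K) :
    AgreeOn (G.Edge x F 𝓜) (G'.Edge x F' (𝓜.restrict G')) K where
  closed := hcl
  iff := by
    intro w hw v
    have hnext : G.owner w.1 = some (1 - x) →
        (𝓜.restrict G').next w.1 w.2 = 𝓜.next w.1 w.2 := by
      intro ho
      have hv := hK _ (hcl w hw _ (edge_opponent w.2 ho))
      exact if_pos ((h.trans_iff _ _).2 ⟨𝓜.legal _ (h.subset (hK w hw)) ho _, hK w hw, hv⟩)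
    unfold Edge
    rw [h.owner]
    constructor
    · intro he
      refine ⟨fun ho => (h.trans_iff _ _).2 ⟨he.1 ho, hK w hw, hK v (hcl w hw v he)⟩,
        fun ho => (he.2.1 ho).trans (hF w hw ho),
        fun ho => (he.2.2.1 ho).trans (hnext ho).symm, he.2.2.2⟩
    · intro he
      exact ⟨fun ho => ((h.trans_iff _ _).1 (he.1 ho)).1,
        fun ho => (he.2.1 ho).trans (hF w hw ho).symm,
        fun ho => (he.2.2.1 ho).trans (hnext ho), he.2.2.2⟩

/-! ### Memoryless strategies -/

/-- The set `K` can be left neither by the opponent nor by a random step, and `F` stays in it. -/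
def IsTrap (G : StochasticGame V) (x : Player) (F : V → V) (K : Set V) : Prop :=
  ∀ s ∈ K, (G.owner s = none ∨ G.owner s = some (1 - x) → ∀ t, G.trans s t → t ∈ K) ∧
    (G.owner s = some x → F s ∈ K)

theorem IsTrap.mem_of_edge {F : V → V} {K : Set V} (hK : G.IsTrap x F K) (hKG : K ⊆ G.states)
    {M : Type} {𝓜 : G.MemoryStructure (1 - x) M} {w v : V × M} (hw : w.1 ∈ K)
    (he : G.Edge x F 𝓜 w v) : v.1 ∈ K := by
  rcases Player.owner_trichotomy (G.owner w.1) x with ho | ho | ho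
  · exact (hK _ hw).1 (Or.inl ho) _ (he.1 ho)
  · rw [he.2.1 ho]; exact (hK _ hw).2 ho
  · rw [he.2.2.1 ho]; exact (hK _ hw).1 (Or.inr ho) _ (𝓜.legal _ (hKG hw) ho _)

/-- Winning almost surely in a sub-game carries over to the game, if the opponent cannot leave the
set `K` of states of the sub-game. -/
theorem WinsAS.of_isSubgame {G' : StochasticGame V} (h : G'.IsSubgame G) {F F' : V → V}
    {K : Set V} (hKG : K ⊆ G'.states) (hK : G.IsTrap x F K)
    (hF : ∀ s ∈ K, G.owner s = some x → F s = F' s) {s : V} (hs : s ∈ K)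
    (hw : G'.WinsAS x F' s) : G.WinsAS x F s := by
  intro M _ 𝓜 m b hb hbot
  have hag := agreeOn_restrict h 𝓜 (K := {w | w.1 ∈ K}) (fun w hw => hF w.1 hw)
    (fun w hw => hKG hw) fun w hw v he => hK.mem_of_edge (hKG.trans h.subset) hw he
  have hb' := hag.mem hs hb
  rw [hag.isDominated_iff hb', ← h.col]
  exact hw M _ m b ((hag.reach_iff hs).1 hb) ((hag.isBottom_iff hb').1 hbot)

theorem WinsPos.of_reachable {F : V → V} {s : V} (h : ∀ (M : Type) [Finite M]
    (𝓜 : G.MemoryStructure (1 - x) M) (m : M), ∃ v, G.WinsPos x F v.1 ∧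
      ReflTransGen (G.Edge x F 𝓜) (s, m) v) : G.WinsPos x F s := by
  intro M _ 𝓜 m
  obtain ⟨v, hv, hsv⟩ := h M 𝓜 m
  obtain ⟨b, hb, h⟩ := hv M 𝓜 v.2
  exact ⟨b, hsv.trans hb, h⟩

/-- A legal memoryless strategy that satisfies a requirement wherever this is possible. -/
theorem exists_isLegal (G : StochasticGame V) (x : Player) (P : V → V → Prop) :
    ∃ F, G.IsLegal x F ∧ ∀ s t, G.trans s t → P s t → G.trans s (F s) ∧ P s (F s) := by
  have : ∀ s, ∃ t, (s ∈ G.states → G.trans s t) ∧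
      ∀ t', G.trans s t' → P s t' → G.trans s t ∧ P s t := by
    intro s
    by_cases h : ∃ t, G.trans s t ∧ P s t
    · obtain ⟨t, ht⟩ := h
      exact ⟨t, fun _ => ht.1, fun _ _ _ => ht⟩
    · by_cases hs : s ∈ G.states
      · obtain ⟨t, ht⟩ := G.exists_succ s hs
        exact ⟨t, fun _ => ht, fun t' h1 h2 => absurd ⟨t', h1, h2⟩ h⟩
      · exact ⟨s, fun h => absurd h hs, fun t' h1 h2 => absurd ⟨t', h1, h2⟩ h⟩
  choose F hF using this
  exact ⟨F, fun s hs _ => (hF s).1 hs, fun s t => (hF s).2 t⟩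

/-! ### Winning almost surely by forcing the largest color -/

/-- If `n` is the largest color, `n ≡ x`, and Player `x` wins with positive probability everywhere
outside of the force set of the states of color `n`, then Player `x` wins almost surely. -/
theorem exists_winsAS_of_winsPos {n : ℕ} (hn : G.HasRank n) (hx : x = Player.ofNat n)
    {T : Set V} (hT : ∀ s ∈ T, G.col s = n) {F' : V → V} (hF' : (G.subForce x T).IsLegal x F')
    (hw : ∀ s ∈ (G.subForce x T).states, (G.subForce x T).WinsPos x F' s) :
    ∃ F, G.IsLegal x F ∧ ∀ s ∈ G.states, G.WinsAS x F s := by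
  obtain ⟨ρ, hρ⟩ := G.exists_rank x T
  have hsub := G.isSubgame_subForce x T
  obtain ⟨F, hF, hFP⟩ := G.exists_isLegal x fun s t =>
    (s ∈ G.force x T → t ∈ G.force x T ∧ ρ t < ρ s) ∧ (s ∉ G.force x T → t = F' s)
  have hF1 : ∀ s ∈ G.force x T, s ∉ T → G.owner s = some x →
      F s ∈ G.force x T ∧ ρ (F s) < ρ s := by
    intro s hs hsT ho
    obtain ⟨t, ht, hst, hlt⟩ := (hρ s hs hsT).2.1 (Or.inr ho)
    exact (hFP s t hst ⟨fun _ => ⟨ht, hlt⟩, fun h => absurd hs h⟩).2.1 hs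
  have hF2 : ∀ s ∈ (G.subForce x T).states, G.owner s = some x → F s = F' s := by
    intro s hs ho
    exact (hFP s (F' s) ((hsub.trans_iff _ _).1 (hF' s hs ho)).1
      ⟨fun h => absurd h hs.2, fun _ => rfl⟩).2.2 hs.2
  refine ⟨F, hF, fun s hs M _ 𝓜 m b hb hbot => ?_⟩
  have hbG : b.1 ∈ G.states := reach_mem_states hF hb hs
  by_cases hc : ∃ c, ReflTransGen (G.Edge x F 𝓜) b c ∧ c.1 ∈ G.force x T
  · obtain ⟨c, hbc, hc⟩ := hc
    obtain ⟨v, hv, hcv⟩ := force_reachable hρ hF1 𝓜 hc c.2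
    exact ⟨n, hx.symm, ⟨v, hbc.trans hcv, hT _ hv⟩,
      fun d hd => hn _ (reach_mem_states hF hd hbG)⟩
  -- otherwise the play does not enter the force set after `b`, and the given strategy reaches some
  -- bottom state with a good color, which is in the same component as `b`
  · push Not at hc
    have hmem : ∀ w, ReflTransGen (G.Edge x F 𝓜) b w → w.1 ∈ (G.subForce x T).states :=
      fun w hw => ⟨reach_mem_states hF hw hbG, hc w hw⟩
    have hag := agreeOn_restrict hsub 𝓜 (K := {w | ReflTransGen (G.Edge x F 𝓜) b w})
      (fun w hw => hF2 w.1 (hmem w hw)) hmem fun w hw v he => ReflTransGen.tail hw he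
    obtain ⟨d, hd, -, hdom⟩ := hw b.1 (hmem b .refl) M (𝓜.restrict _) b.2
    have hd' := (hag.reach_iff (w := b) .refl).2 hd
    exact ((hag.isDominated_iff hd').2 hdom).of_reach hbot hd'

/-! ### Winning with positive probability in layers -/

/-- The game `G ⊖ X ⊖ Z` where `X = Force^{1-x}(G, U)` and `Z` is the set of states of `G ⊖ X` from
which Player `x` can force a visit to the color `n`. -/
noncomputable def core (G : StochasticGame V) (n : ℕ) (x : Player) (U : Set V) :
    StochasticGame V :=
  (G.subForce (1 - x) U).subForce x
    {s ∈ (G.subForce (1 - x) U).states | (G.subForce (1 - x) U).col s = n}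

theorem isSubgame_core (G : StochasticGame V) (n : ℕ) (x : Player) (U : Set V) :
    (G.core n x U).IsSubgame G :=
  (isSubgame_subForce _ _ _).trans (isSubgame_subForce _ _ _)

theorem HasRank.core {n : ℕ} (hn : G.HasRank (n + 1)) (x : Player) (U : Set V) :
    (G.core (n + 1) x U).HasRank n := by
  intro s hs
  have h1 : G.col s ≤ n + 1 := hn s hs.1.1
  have h2 : G.col s ≠ n + 1 := fun h => hs.2 (subset_force _ _ _ ⟨hs.1, h⟩)
  exact Nat.le_of_lt_succ (lt_of_le_of_ne h1 h2)

/-- The opponent of Player `1 - x` and random steps leave the core only towards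
`Force^{1-x}(G, U)`. -/
theorem trans_core {n : ℕ} {U : Set V} {s t : V} (hs : s ∈ (G.core n x U).states)
    (ho : G.owner s = none ∨ G.owner s = some x) (hst : G.trans s t)
    (ht : t ∉ G.force (1 - x) U) : (G.core n x U).trans s t := by
  have hst' : (G.subForce (1 - x) U).trans s t := ⟨hst, hs.1, (G.trans_mem hst).2, ht⟩
  exact ⟨hst', hs, trans_subForce _ x _ hs ho hst'⟩

/-- Player `1 - x` wins with positive probability in all layers `Force^{1-x}(G, U α) ∪ D α`, if he
wins almost surely in the part `D α` of the core of the `α`-th layer. -/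
theorem exists_winsPos_layers {A : Set V} (hfin : A.Finite) (hA : G.MeetsClosable A) {n : ℕ}
    {Y U D : Ordinal.{u} → Set V} (hU : ∀ α, U α = ⋃ β : Set.Iio α, Y β.1)
    (hY : ∀ α, Y α = G.force (1 - x) (U α) ∪ D α)
    (hD : ∀ α, D α ⊆ (G.core n x (U α)).states) {f : Ordinal.{u} → V → V}
    (hf : ∀ α, (G.core n x (U α)).IsLegal (1 - x) (f α))
    (htrap : ∀ α, (G.core n x (U α)).IsTrap (1 - x) (f α) (D α))
    (hw : ∀ α, ∀ s ∈ D α, (G.core n x (U α)).WinsAS (1 - x) (f α) s) :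
    ∃ F, G.IsLegal (1 - x) F ∧ ∀ α, ∀ s ∈ Y α, G.WinsPos (1 - x) F s := by
  choose ρ hρ using fun α => G.exists_rank (1 - x) (U α)
  have hUY : ∀ {α β}, α < β → Y α ⊆ U β := fun {α β} h => by
    rw [hU β]; exact Set.subset_iUnion (fun γ : Set.Iio β => Y γ.1) ⟨α, h⟩
  -- a state belongs to `Y α` and not to `U α` for at most one `α`
  have huniq : ∀ {α β s}, s ∈ Y α → s ∉ U α → s ∈ Y β → s ∉ U β → α = β :=
    fun {α β s} h1 h2 h3 h4 => le_antisymm (not_lt.1 fun h => h2 (hUY h h3))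
      (not_lt.1 fun h => h4 (hUY h h1))
  have hDX : ∀ α, ∀ s ∈ D α, s ∉ G.force (1 - x) (U α) := fun α s hs => (hD α hs).1.2
  obtain ⟨F, hF, hFP⟩ := G.exists_isLegal (1 - x) fun s t => ∀ α, s ∈ Y α → s ∉ U α →
    (s ∈ G.force (1 - x) (U α) → t ∈ G.force (1 - x) (U α) ∧ ρ α t < ρ α s) ∧
    (s ∈ D α → t = f α s)
  have hF1 : ∀ α, ∀ s ∈ G.force (1 - x) (U α), s ∉ U α → G.owner s = some (1 - x) →
      F s ∈ G.force (1 - x) (U α) ∧ ρ α (F s) < ρ α s := by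
    intro α s hs hsU ho
    have hsY : s ∈ Y α := hY α ▸ Or.inl hs
    obtain ⟨t, ht, hst, hlt⟩ := (hρ α s hs hsU).2.1 (Or.inr ho)
    refine ((hFP s t hst fun β hβ hβU => ?_).2 α hsY hsU).1 hs
    obtain rfl := huniq hsY hsU hβ hβU
    exact ⟨fun _ => ⟨ht, hlt⟩, fun h => absurd hs (hDX _ s h)⟩
  have hF2 : ∀ α, ∀ s ∈ D α, G.owner s = some (1 - x) → F s = f α s := by
    intro α s hs ho
    have hsY : s ∈ Y α := hY α ▸ Or.inr hs
    have hsU : s ∉ U α := fun h => hDX α s hs (subset_force _ _ _ h)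
    have hst := ((isSubgame_core G n x (U α)).trans_iff _ _).1 (hf α s (hD α hs) ho)
    refine ((hFP s _ hst.1 fun β hβ hβU => ?_).2 α hsY hsU).2 hs
    obtain rfl := huniq hsY hsU hβ hβU
    exact ⟨fun h => absurd h (hDX _ s hs), fun _ => rfl⟩
  refine ⟨F, hF, fun α => ?_⟩
  induction α using WellFoundedLT.induction with
  | ind α ih =>
    have hXw : ∀ s ∈ G.force (1 - x) (U α), G.WinsPos (1 - x) F s := by
      intro s hs
      refine WinsPos.of_reachable fun M _ 𝓜 m => ?_
      obtain ⟨v, hv, hsv⟩ := force_reachable (hρ α) (hF1 α) 𝓜 hs m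
      rw [hU α] at hv
      obtain ⟨⟨β, hβ⟩, hvβ⟩ := Set.mem_iUnion.1 hv
      exact ⟨v, ih β hβ v.1 hvβ, hsv⟩
    intro s hs
    rw [hY α] at hs
    rcases hs with hs | hs
    · exact hXw s hs
    intro M _ 𝓜 m
    by_cases hX : ∃ v, ReflTransGen (G.Edge (1 - x) F 𝓜) (s, m) v ∧ v.1 ∈ G.force (1 - x) (U α)
    · obtain ⟨v, hsv, hv⟩ := hX
      obtain ⟨b, hvb, hb⟩ := hXw v.1 hv M 𝓜 v.2
      exact ⟨b, hsv.trans hvb, hb⟩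
    -- otherwise the play stays in `D α`, against an opponent who never leaves the core
    push Not at hX
    have hsub := isSubgame_core G n x (U α)
    have hcl : ∀ w ∈ {w : V × M | w.1 ∈ D α ∧ ReflTransGen (G.Edge (1 - x) F 𝓜) (s, m) w},
        ∀ v, G.Edge (1 - x) F 𝓜 w v →
          v ∈ {w : V × M | w.1 ∈ D α ∧ ReflTransGen (G.Edge (1 - x) F 𝓜) (s, m) w} := by
      rintro w ⟨hwD, hsw⟩ v he
      have hsv := hsw.tail he
      refine ⟨?_, hsv⟩
      have hwc := hD α hwD
      have hst := he.trans hF (hsub.subset hwc)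
      have htr := htrap α w.1 hwD
      rw [hsub.owner] at htr
      rcases Player.owner_trichotomy (G.owner w.1) (1 - x) with ho | ho | ho
      · exact htr.1 (Or.inl ho) _ (trans_core hwc (Or.inl ho) hst (hX v hsv))
      · rw [he.2.1 ho, hF2 α _ hwD ho]
        exact htr.2 ho
      · refine htr.1 (Or.inr ho) _ (trans_core hwc (Or.inr ?_) hst (hX v hsv))
        rw [ho, Player.one_sub_one_sub]
    have hag := agreeOn_restrict hsub 𝓜 (fun w hw => hF2 α w.1 hw.1) (fun w hw => hD α hw.1) hcl
    have hs0 : (s, m) ∈ {w : V × M | w.1 ∈ D α ∧ ReflTransGen (G.Edge (1 - x) F 𝓜) (s, m) w} :=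
      ⟨hs, .refl⟩
    obtain ⟨b, hsb, hb⟩ := exists_reachable_isBottom hfin hA hF 𝓜 (w := (s, m))
      (hsub.subset (hD α hs))
    have hbK := hag.mem hs0 hsb
    refine ⟨b, hsb, hb, (hag.isDominated_iff hbK).2 ?_⟩
    rw [← hsub.col]
    exact hw α s hs M _ m b ((hag.reach_iff hs0).1 hsb) ((hag.isBottom_iff hbK).1 hb)

/-! ### The sets `C_n` -/

theorem C_subset (n : ℕ) (G : StochasticGame V) : C n G ⊆ G.states := by
  cases n with
  | zero => exact subset_rfl
  | succ n => exact Set.sdiff_subset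

theorem exists_fixed_of_monotone {X : Ordinal.{u} → Set V} (hX : Monotone X) :
    ∃ γ, X (γ + 1) = X γ := by
  by_contra! hcon
  refine not_injective_of_ordinal.{u} X (StrictMono.injective fun α β h => ?_)
  have h1 : X α < X (α + 1) := lt_of_le_of_ne (hX (by simp)) (hcon α).symm
  exact h1.trans_le (hX (by simpa using Order.succ_le_of_lt h))

/-- The complement of `C_{n+1}` is exhausted by layers, and the core of the last layer `γ` contains
no state of `C_n`. -/
theorem exists_layers (n : ℕ) (G : StochasticGame V) (hx : x = Player.ofNat (n + 1)) :
    ∃ (Y U : Ordinal.{u} → Set V) (γ : Ordinal.{u}), (∀ α, U α = ⋃ β : Set.Iio α, Y β.1) ∧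
      (∀ α, Y α = G.force (1 - x) (U α) ∪ C n (G.core (n + 1) x (U α))) ∧
      C (n + 1) G = G.states \ G.force (1 - x) (U γ) ∧ C n (G.core (n + 1) x (U γ)) = ∅ := by
  subst hx
  set x := Player.ofNat (n + 1)
  let stepY : Set V → Set V := fun U => G.force (1 - x) U ∪ C n (G.core (n + 1) x U)
  let Y : Ordinal.{u} → Set V := iter stepY
  let U : Ordinal.{u} → Set V := fun α => ⋃ β : Set.Iio α, Y β.1
  let X : Ordinal.{u} → Set V := fun α => G.force (1 - x) (U α)
  have hY : ∀ α, Y α = X α ∪ C n (G.core (n + 1) x (U α)) := fun α => by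
    change iter stepY α = _
    rw [iter]
  have hYX : ∀ {α β}, α < β → Y α ⊆ X β := fun {α β} h =>
    (Set.subset_iUnion (fun γ : Set.Iio β => Y γ.1) ⟨α, h⟩).trans (subset_force _ _ _)
  have hX : Monotone X := by
    intro α β h
    rcases h.lt_or_eq with h | rfl
    · refine Set.Subset.trans ?_ (hYX h)
      rw [hY]
      exact Set.subset_union_left
    · exact le_rfl
  have hγ : X (sInf {γ | X (γ + 1) = X γ} + 1) = X (sInf {γ | X (γ + 1) = X γ}) :=
    csInf_mem (s := {γ | X (γ + 1) = X γ}) (exists_fixed_of_monotone hX)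
  refine ⟨Y, U, sInf {γ | X (γ + 1) = X γ}, fun _ => rfl, hY, rfl, ?_⟩
  rw [Set.eq_empty_iff_forall_notMem]
  intro s hs
  have h1 : s ∈ Y (sInf {γ | X (γ + 1) = X γ}) := by
    rw [hY]; exact Or.inr hs
  have h2 := hYX (Order.lt_add_one_iff.2 le_rfl) h1
  rw [hγ] at h2
  exact (C_subset _ _ hs).1.2 h2

theorem MeetsClosable.core {A : Set V} (hA : G.MeetsClosable A) (n : ℕ) (x : Player) (U : Set V) :
    (G.core n x U).MeetsClosable A :=
  (hA.subForce _ _).subForce _ _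

/-- The qualitative form of determinacy: with `x ≡ n`, Player `x` wins almost surely on `C_n`, and
Player `1 - x` wins with positive probability on the complement. -/
theorem exists_winning {A : Set V} (hfin : A.Finite) (n : ℕ) (G : StochasticGame V)
    (hn : G.HasRank n) (hA : G.MeetsClosable A) (x y : Player) (hx : x = Player.ofNat n)
    (hy : y = 1 - x) :
    ∃ F F', G.IsLegal x F ∧ G.IsLegal y F' ∧ G.IsTrap x F (C n G) ∧
      (∀ s ∈ C n G, G.WinsAS x F s) ∧ ∀ s ∈ G.states \ C n G, G.WinsPos y F' s := by
  induction n generalizing G x y with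
  | zero =>
    obtain ⟨F, hF, -⟩ := G.exists_isLegal x fun _ _ => True
    obtain ⟨F', hF', -⟩ := G.exists_isLegal y fun _ _ => True
    refine ⟨F, F', hF, hF', fun s hs => ⟨fun _ t ht => (G.trans_mem ht).2,
      fun ho => (G.trans_mem (hF s hs ho)).2⟩, fun s hs M _ 𝓜 m b hb _ => ?_,
      fun s hs => absurd hs.1 hs.2⟩
    have hcol : ∀ c, ReflTransGen (G.Edge x F 𝓜) b c → G.col c.1 ≤ 0 := fun c hc =>
      hn _ (reach_mem_states hF (hb.trans hc) hs)
    exact ⟨0, hx.symm, ⟨b, .refl, Nat.le_zero.1 (hcol b .refl)⟩, hcol⟩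
  | succ n ih =>
    subst hy
    have hx' : 1 - x = Player.ofNat n := by rw [Player.ofNat_succ n, hx]
    obtain ⟨Y, U, γ, hU, hY, hC, hempty⟩ := exists_layers n G hx
    choose f f' hf hf' htrap hAS hPos using fun α => ih (G.core (n + 1) x (U α)) (hn.core x _)
      (hA.core _ _ _) (1 - x) x hx' (Player.one_sub_one_sub x).symm
    obtain ⟨F', hF', hF'w⟩ := exists_winsPos_layers hfin hA hU hY (fun α => C_subset _ _) hf htrap
      hAS
    obtain ⟨F₀, hF₀, hF₀w⟩ := exists_winsAS_of_winsPos (G := G.subForce (1 - x) (U γ))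
      (hn.subForce _ _) hx (fun s hs => hs.2) (hf' γ)
      (fun s hs => hPos γ s ⟨hs, by rw [hempty]; exact Set.notMem_empty s⟩)
    have hsub := G.isSubgame_subForce (1 - x) (U γ)
    have hCs : C (n + 1) G = (G.subForce (1 - x) (U γ)).states := hC
    obtain ⟨F, hF, hFP⟩ := G.exists_isLegal x fun s t =>
      s ∈ (G.subForce (1 - x) (U γ)).states → t = F₀ s
    have hFF₀ : ∀ s ∈ C (n + 1) G, G.owner s = some x → F s = F₀ s := by
      intro s hs ho
      rw [hCs] at hs
      exact (hFP s (F₀ s) ((hsub.trans_iff _ _).1 (hF₀ s hs ho)).1 fun _ => rfl).2 hs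
    have htr : G.IsTrap x F (C (n + 1) G) := by
      intro s hs
      refine ⟨fun ho t hst => ?_, fun ho => ?_⟩
      · rw [hCs] at hs ⊢
        exact G.trans_subForce _ _ hs ho hst
      · rw [hFF₀ s hs ho]
        rw [hCs] at hs ⊢
        exact ((hsub.trans_iff _ _).1 (hF₀ s hs ho)).2.2
    refine ⟨F, F', hF, hF', htr, fun s hs => ?_, fun s hs => ?_⟩
    · exact WinsAS.of_isSubgame hsub hCs.subset htr hFF₀ hs (hF₀w s (hCs ▸ hs))
    · refine hF'w γ s ?_
      rw [hY]
      rw [hC] at hs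
      by_contra hcon
      exact hs.2 ⟨hs.1, fun h => hcon (Or.inl h)⟩

/-! ### From finite words to pairs of a state and a memory configuration -/

open MarkovChain

instance (V : Type u) : DiscreteMeasurableSpace (Hist V) := ⟨fun _ => trivial⟩

theorem histMeasure_eq_law (G : StochasticGame V) (σ : G.Profile) (s : V) :
    G.histMeasure σ s = law (G.stepHist σ) ⟨[], s⟩ := rfl

/-- The Markov chain of the pairs of a state and a memory configuration, if Player `x` uses the
memoryless strategy `F` and Player `1 - x` uses the memory structure `𝓜`. -/
noncomputable def pairStep (G : StochasticGame V) (x : Player) (F : V → V)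
    (𝓜 : G.MemoryStructure (1 - x) M) (w : V × M) : PMF (V × M) :=
  (match G.owner w.1 with
    | none => G.P w.1
    | some z => PMF.pure (if z = x then F w.1 else 𝓜.next w.1 w.2)).map
      fun t => (t, 𝓜.update w.1 w.2)

theorem mem_support_pairStep {F : V → V} {𝓜 : G.MemoryStructure (1 - x) M} {w v : V × M}
    (hw : w.1 ∈ G.states) : v ∈ (G.pairStep x F 𝓜 w).support ↔ G.Edge x F 𝓜 w v := by
  obtain ⟨t, m'⟩ := v
  have hne : (x : Player) ≠ 1 - x := (Player.one_sub_ne x).symm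
  rcases Player.owner_trichotomy (G.owner w.1) x with ho | ho | ho
  · have hP : ∀ a, a ∈ (G.P w.1).support ↔ G.trans w.1 a := fun a => by
      rw [PMF.mem_support_iff, ← pos_iff_ne_zero, G.P_pos_iff _ hw ho]
    simp only [pairStep, Edge, ho, PMF.support_map, Set.mem_image, hP, Prod.mk.injEq]
    simp [eq_comm]
  · simp only [pairStep, Edge, ho, PMF.support_map, Set.mem_image, PMF.mem_support_pure_iff,
      Prod.mk.injEq]
    simp [eq_comm, hne]
  · simp only [pairStep, Edge, ho, PMF.support_map, Set.mem_image, PMF.mem_support_pure_iff,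
      Prod.mk.injEq]
    simp [eq_comm, hne]

theorem agreeOn_support {F : V → V} (hF : G.IsLegal x F) (𝓜 : G.MemoryStructure (1 - x) M) :
    AgreeOn (G.Edge x F 𝓜) (fun w v => v ∈ (G.pairStep x F 𝓜 w).support)
      {w | w.1 ∈ G.states} where
  closed _ hw _ he := (G.trans_mem (he.trans hF hw)).2
  iff _ hw _ := (mem_support_pairStep hw).symm

/-- The strategies `σ` are the memoryless strategy `F` of Player `x` and the strategy of Player
`1 - x` that is induced by `𝓜`. -/
def Follows (G : StochasticGame V) (σ : G.Profile) (x : Player) (F : V → V)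
    (𝓜 : G.MemoryStructure (1 - x) M) : Prop :=
  (∀ h, G.IsPathOf x h → (σ x).move h = some (F h.cur)) ∧
    ∀ h, G.IsPathOf (1 - x) h → (σ (1 - x)).move h = some (𝓜.next h.cur (𝓜.run h.past))

/-- The current state and the current memory configuration. -/
def proj (𝓜 : G.MemoryStructure (1 - x) M) (h : Hist V) : V × M := (h.cur, 𝓜.run h.past)

theorem Follows.map_stepHist {σ : G.Profile} {F : V → V} {𝓜 : G.MemoryStructure (1 - x) M}
    (hσ : G.Follows σ x F 𝓜) {h : Hist V} (hh : G.IsPath h) :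
    (G.stepHist σ h).map (proj 𝓜) = G.pairStep x F 𝓜 (proj 𝓜 h) := by
  have hmap : proj 𝓜 ∘ (fun t => (⟨h.past ++ [h.cur], t⟩ : Hist V)) =
      fun t => (t, 𝓜.update h.cur (𝓜.run h.past)) := by
    ext t <;> simp [proj, MemoryStructure.run]
  rw [stepHist, PMF.map_comp, hmap, pairStep]
  have hne : (x : Player) ≠ 1 - x := (Player.one_sub_ne x).symm
  congr 1
  rcases Player.owner_trichotomy (G.owner h.cur) x with ho | ho | ho
  · simp [step, proj, ho]
  · simp [step, proj, ho, hσ.1 h ⟨hh, ho⟩]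
  · simp [step, proj, ho, hσ.2 h ⟨hh, ho⟩, hne.symm]

theorem IsPath.append {h : Hist V} (hh : G.IsPath h) {t : V} (ht : G.trans h.cur t) :
    G.IsPath ⟨h.past ++ [h.cur], t⟩ := by
  refine ⟨(G.trans_mem ht).2, ?_⟩
  rw [List.isChain_append]
  refine ⟨hh.2, List.isChain_singleton _, fun a ha b hb => ?_⟩
  simp at ha hb
  rwa [← ha, ← hb]

theorem isPath_singleton {s : V} (hs : s ∈ G.states) : G.IsPath ⟨[], s⟩ :=
  ⟨hs, List.isChain_singleton _⟩

theorem trans_of_mem_support_step {σ : G.Profile} (hσ : ∀ y, (σ y).IsTotal) {h : Hist V}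
    (hh : G.IsPath h) {t : V} (ht : t ∈ (G.step σ h).support) : G.trans h.cur t := by
  unfold step at ht
  split at ht
  · rename_i ho
    rw [PMF.mem_support_iff, ← pos_iff_ne_zero] at ht
    exact (G.P_pos_iff _ hh.1 ho t).1 ht
  · rename_i y ho
    obtain ⟨t', ht'⟩ := Option.ne_none_iff_exists'.1 (hσ y h ⟨hh, ho⟩)
    rw [ht', PMF.mem_support_pure_iff] at ht
    rw [ht]
    exact (σ y).legal h ⟨hh, ho⟩ t' ht'

theorem isClosed_isPath {σ : G.Profile} (hσ : ∀ y, (σ y).IsTotal) :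
    MarkovChain.IsClosed (G.stepHist σ) {h | G.IsPath h} := by
  intro h hh h' hh'
  rw [stepHist, PMF.support_map] at hh'
  obtain ⟨t, ht, rfl⟩ := hh'
  exact hh.append (trans_of_mem_support_step hσ hh ht)

theorem Follows.hitProb_eq {σ : G.Profile} {F : V → V} {𝓜 : G.MemoryStructure (1 - x) M}
    (hσ : G.Follows σ x F 𝓜) (ht : ∀ y, (σ y).IsTotal) (D : Set (V × M)) {h : Hist V}
    (hh : G.IsPath h) :
    hitProb (G.stepHist σ) (proj 𝓜 ⁻¹' D) h = hitProb (G.pairStep x F 𝓜) D (proj 𝓜 h) :=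
  hitProb_map (isClosed_isPath ht) (fun _ hh => hσ.map_stepHist hh) D hh

theorem prob_hit (σ : G.Profile) (A : Set V) (s : V) :
    G.prob σ s {ρ | ∃ k, ρ k ∈ A} = hitProb (G.stepHist σ) {h | h.cur ∈ A} ⟨[], s⟩ := by
  rw [prob, histMeasure_eq_law, ← law_hit]
  rfl

/-- An attractor meets all closable sets, since the players can stay in such a set. -/
theorem IsAttractor.meetsClosable {A : Set V} (hA : G.IsAttractor A) : G.MeetsClosable A := by
  intro Q hQ ⟨s, hs⟩ hc
  by_contra hne
  choose F hF hFQ using fun y => G.exists_isLegal y fun s t => s ∈ Q → t ∈ Q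
  let σ : G.Profile := fun y =>
    { move := fun h => some (F y h.cur)
      legal := fun h hh t ht => by
        rw [← Option.some_inj.1 ht]; exact hF y _ hh.1.1 hh.2 }
  have hcl : MarkovChain.IsClosed (G.stepHist σ) {h | h.cur ∈ Q} := by
    intro h hh h' hh'
    rw [stepHist, PMF.support_map] at hh'
    obtain ⟨t, ht, rfl⟩ := hh'
    change t ∈ Q
    unfold step at ht
    split at ht
    · rename_i ho
      rw [PMF.mem_support_iff, ← pos_iff_ne_zero] at ht
      exact hc.2 _ hh ho t ((G.P_pos_iff _ (hQ hh) ho t).1 ht)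
    · rename_i y ho
      obtain ⟨t', ht', hst'⟩ := hc.1 _ hh
      rw [(PMF.mem_support_pure_iff _ _).1 ht]
      exact (hFQ y _ t' hst' fun _ => ht').2 hh
  have h1 := hA.2 s (hQ hs) σ fun y h _ => by simp [σ]
  rw [prob_hit, ← law_hit] at h1
  have h2 : law (G.stepHist σ) ⟨[], s⟩ {ω | ∃ j, ω j ∈ {h : Hist V | h.cur ∈ A}} = 0 := by
    rw [measure_eq_zero_iff_ae_notMem]
    filter_upwards [ae_forall_mem hcl (w := ⟨[], s⟩) hs] with ω hω ⟨j, hj⟩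
    exact hne ⟨_, hω j, hj⟩
  rw [h2] at h1
  exact zero_ne_one h1

/-- An attractor is visited almost surely from all memory configurations. -/
theorem IsAttractor.hitProb_eq_one {A : Set V} (hA : G.IsAttractor A) {F : V → V}
    (hF : G.IsLegal x F) (𝓜 : G.MemoryStructure (1 - x) M) {w : V × M} (hw : w.1 ∈ G.states) :
    hitProb (G.pairStep x F 𝓜) (A ×ˢ Set.univ) w = 1 := by
  let 𝓜' : G.MemoryStructure (1 - x) M := { 𝓜 with init := w.2 }
  let σ : G.Profile := fun y =>
    { move := fun h => some (if y = x then F h.cur else 𝓜'.next h.cur (𝓜'.run h.past))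
      legal := fun h hh t ht => by
        rw [← Option.some_inj.1 ht]
        split_ifs with hy
        · subst hy; exact hF _ hh.1.1 hh.2
        · refine 𝓜'.legal _ hh.1.1 ?_ _
          rw [hh.2]
          exact Player.owner_cases _ x (by simpa using hy) }
  have hσ : G.Follows σ x F 𝓜' := ⟨fun h _ => by simp [σ], fun h _ => by
    simp [σ, Player.one_sub_ne x]⟩
  have ht : ∀ y, (σ y).IsTotal := fun y h _ => by simp [σ]
  have h1 := hA.2 w.1 hw σ ht
  have h2 := hσ.hitProb_eq ht (A ×ˢ Set.univ) (isPath_singleton hw)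
  rw [prob_hit] at h1
  have h3 : proj 𝓜' ⁻¹' (A ×ˢ Set.univ) = {h | h.cur ∈ A} := by
    ext h; simp [proj]
  rw [h3, h1] at h2
  exact h2.symm

/-! ### The probability of the parity condition -/

/-- The sequences of finite words whose last states satisfy the parity condition. -/
def histParity (G : StochasticGame V) (y : Player) : Set (ℕ → Hist V) :=
  {ω | (fun k => (ω k).cur) ∈ G.parity y}

theorem measurableSet_histParity (G : StochasticGame V) (y : Player) :
    MeasurableSet (G.histParity y) := by
  have h : ∀ (k : ℕ) (p : ℕ → Prop), Measurable fun ω : ℕ → Hist V => p (G.col (ω k).cur) :=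
    fun k p => (Measurable.of_discrete (f := fun h : Hist V => p (G.col h.cur))).comp
      (measurable_pi_apply k)
  refine Measurable.setOf (Measurable.exists fun i => measurable_const.and ?_)
  simp only [frequently_atTop, eventually_atTop]
  exact (Measurable.forall fun a => Measurable.exists fun b => measurable_const.and
    (h b (· = i))).and (Measurable.exists fun a => Measurable.forall fun b =>
      measurable_const.imp (h b (· ≤ i)))

theorem prob_parity (σ : G.Profile) (y : Player) (s : V) :
    G.prob σ s (G.parity y) = law (G.stepHist σ) ⟨[], s⟩ (G.histParity y) := rfl

theorem disjoint_parity (G : StochasticGame V) (y : Player) :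
    Disjoint (G.parity y) (G.parity (1 - y)) := by
  rw [Set.disjoint_left]
  rintro ρ ⟨i, hi, hif, hie⟩ ⟨j, hj, hjf, hje⟩
  obtain ⟨k, hk1, hk2⟩ := (hif.and_eventually hje).exists
  obtain ⟨l, hl1, hl2⟩ := (hjf.and_eventually hie).exists
  have : i = j := by omega
  subst this
  exact Player.one_sub_ne y (hj.symm.trans hi)

theorem prob_parity_add_le (σ : G.Profile) (y : Player) (s : V) :
    G.prob σ s (G.parity y) + G.prob σ s (G.parity (1 - y)) ≤ 1 := by
  rw [prob_parity, prob_parity, ← measure_union _ (measurableSet_histParity G _)]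
  · exact prob_le_one
  · rw [Set.disjoint_left]
    exact fun ω h1 h2 => Set.disjoint_left.1 (G.disjoint_parity y) h1 h2

theorem tsum_law_histParity_le (σ : G.Profile) (y : Player) (h : Hist V) :
    ∑' t, G.stepHist σ h t * law (G.stepHist σ) t (G.histParity y) ≤
      law (G.stepHist σ) h (G.histParity y) := by
  rw [← law_shift _ _ (measurableSet_histParity G y)]
  refine measure_mono ?_
  rintro ω ⟨i, hi, hf, he⟩
  refine ⟨i, hi, ?_, ?_⟩
  · rw [frequently_atTop] at hf ⊢
    intro a
    obtain ⟨b, hb, h⟩ := hf a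
    exact ⟨b + 1, hb.trans (Nat.le_succ b), h⟩
  · rw [eventually_atTop] at he ⊢
    obtain ⟨a, ha⟩ := he
    refine ⟨a + 1, fun b hb => ?_⟩
    have := ha (b - 1) (by omega)
    change G.col (ω (b - 1 + 1)).cur ≤ i at this
    rwa [Nat.sub_add_cancel (by omega)] at this

section Attractor

variable {A : Set V} [Finite M] {F : V → V} {𝓜 : G.MemoryStructure (1 - x) M} {σ : G.Profile}

/-- In the finite-memory chain, sets that are reachable from all reachable states are visited
almost surely. -/
theorem IsAttractor.hitProb_eq_one_of_reachable (hA : G.IsAttractor A) (hfin : A.Finite)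
    (hF : G.IsLegal x F) {w₀ : V × M} (hw₀ : w₀.1 ∈ G.states) {D : Set (V × M)}
    (hD : ∀ w, ReflTransGen (G.Edge x F 𝓜) w₀ w → ∃ v ∈ D, ReflTransGen (G.Edge x F 𝓜) w v)
    {w : V × M} (hw : ReflTransGen (G.Edge x F 𝓜) w₀ w) :
    hitProb (G.pairStep x F 𝓜) D w = 1 := by
  refine MarkovChain.hitProb_eq_one (A := A ×ˢ Set.univ)
    (K := {w | ReflTransGen (G.Edge x F 𝓜) w₀ w}) (fun w hw v hv => ?_)
    (hfin.prod Set.finite_univ) (fun w hw => ?_) (fun w hw => ?_) hw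
  · exact ReflTransGen.tail hw ((mem_support_pairStep (reach_mem_states hF hw hw₀)).1 hv)
  · exact hA.hitProb_eq_one hF 𝓜 (reach_mem_states hF hw hw₀)
  · obtain ⟨v, hv, hwv⟩ := hD w hw
    exact ⟨v, hv, ((agreeOn_support hF 𝓜).reach_iff (reach_mem_states hF hw hw₀)).1 hwv⟩

/-- From a bottom state, almost surely all reachable states are visited infinitely often, and
therefore the largest reachable color decides the parity condition. -/
theorem Follows.ae_parity (hA : G.IsAttractor A) (hfin : A.Finite) (hF : G.IsLegal x F)
    (hσ : G.Follows σ x F 𝓜) (ht : ∀ y, (σ y).IsTotal) {h : Hist V} (hh : G.IsPath h) {y : Player}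
    (hb : IsBottom (G.Edge x F 𝓜) (proj 𝓜 h))
    (hd : IsDominated (G.Edge x F 𝓜) (fun w => G.col w.1) y (proj 𝓜 h)) :
    law (G.stepHist σ) h (G.histParity y) = 1 := by
  obtain ⟨i, hi, ⟨c, hbc, hci⟩, hle⟩ := hd
  let K : Set (Hist V) := {h' | G.IsPath h' ∧ ReflTransGen (G.Edge x F 𝓜) (proj 𝓜 h) (proj 𝓜 h')}
  have hK : MarkovChain.IsClosed (G.stepHist σ) K := by
    rintro h₁ ⟨hp, hr⟩ h₂ hs
    refine ⟨isClosed_isPath ht _ hp _ hs, hr.tail ?_⟩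
    rw [← mem_support_pairStep (w := proj 𝓜 h₁) hp.1, ← hσ.map_stepHist hp, PMF.support_map]
    exact ⟨h₂, hs, rfl⟩
  have hhit : ∀ h' ∈ K, hitProb (G.stepHist σ) (proj 𝓜 ⁻¹' {c}) h' = 1 := by
    intro h' hh'
    rw [hσ.hitProb_eq ht _ hh'.1]
    exact hA.hitProb_eq_one_of_reachable hfin hF hh.1
      (fun w hw => ⟨c, Set.mem_singleton c, (hb w hw).trans hbc⟩) hh'.2
  have hhK : h ∈ K := ⟨hh, .refl⟩
  rw [← mem_ae_iff_prob_eq_one (measurableSet_histParity G y)]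
  filter_upwards [ae_forall_mem hK hhK, ae_frequently hK hhit hhK] with ω h1 h2
  refine ⟨i, hi, h2.mono fun k hk => ?_, .of_forall fun k => hle _ (h1 k).2⟩
  rw [← hci, ← Set.mem_singleton_iff.1 hk]
  rfl

theorem Follows.hitProb_le_prob_parity (hA : G.IsAttractor A) (hfin : A.Finite)
    (hF : G.IsLegal x F) (hσ : G.Follows σ x F 𝓜) (ht : ∀ y, (σ y).IsTotal) {s : V}
    (hs : s ∈ G.states) {y : Player} {B : Set (V × M)}
    (hB : ∀ b ∈ B, IsBottom (G.Edge x F 𝓜) b ∧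
      IsDominated (G.Edge x F 𝓜) (fun w => G.col w.1) y b) :
    hitProb (G.pairStep x F 𝓜) B (s, 𝓜.init) ≤ G.prob σ s (G.parity y) := by
  have h := mul_hitProb_le (isClosed_isPath ht) (D := proj 𝓜 ⁻¹' B) (c := 1)
    (fun h _ => tsum_law_histParity_le σ y h)
    (fun h hh hhB => (hσ.ae_parity hA hfin hF ht hh (hB _ hhB).1 (hB _ hhB).2).ge)
    (isPath_singleton hs)
  rw [hσ.hitProb_eq ht B (isPath_singleton hs), one_mul] at h
  exact h

theorem WinsAS.prob_eq_one {s : V} (hw : G.WinsAS x F s) (hA : G.IsAttractor A)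
    (hfin : A.Finite) (hF : G.IsLegal x F) (hσ : G.Follows σ x F 𝓜) (ht : ∀ y, (σ y).IsTotal)
    (hs : s ∈ G.states) : G.prob σ s (G.parity x) = 1 := by
  refine le_antisymm (le_self_add.trans (prob_parity_add_le σ x s)) ?_
  rw [← hA.hitProb_eq_one_of_reachable hfin hF (𝓜 := 𝓜) (w₀ := (s, 𝓜.init)) hs
    (D := {b | ReflTransGen (G.Edge x F 𝓜) (s, 𝓜.init) b ∧ IsBottom (G.Edge x F 𝓜) b})
    (fun w hsw => ?_) .refl]
  · exact hσ.hitProb_le_prob_parity hA hfin hF ht hs fun b hb => ⟨hb.2, hw M 𝓜 _ b hb.1 hb.2⟩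
  · obtain ⟨b, hwb, hb⟩ := exists_reachable_isBottom hfin hA.meetsClosable hF 𝓜
      (reach_mem_states hF hsw hs)
    exact ⟨b, ⟨hsw.trans hwb, hb⟩, hwb⟩

theorem WinsPos.prob_pos {s : V} (hw : G.WinsPos x F s) (hA : G.IsAttractor A)
    (hfin : A.Finite) (hF : G.IsLegal x F) (hσ : G.Follows σ x F 𝓜) (ht : ∀ y, (σ y).IsTotal)
    (hs : s ∈ G.states) : 0 < G.prob σ s (G.parity x) := by
  obtain ⟨b, hsb, hb⟩ := hw M 𝓜 𝓜.init
  obtain ⟨p, hp, hpb⟩ := exists_gain (K := Set.univ) (c := 0) (d := 1)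
    (e := hitProb (G.pairStep x F 𝓜) {b}) (fun _ _ _ _ => trivial)
    (fun w _ => tsum_hitProb_le _ _ w) (fun _ _ => zero_le)
    (((agreeOn_support hF 𝓜).reach_iff (w := (s, 𝓜.init)) hs).1 hsb) trivial
    (by rw [hitProb_of_mem _ (Set.mem_singleton b), zero_add])
  rw [zero_add, mul_one] at hpb
  refine (hp.trans_le hpb).trans_le (hσ.hitProb_le_prob_parity hA hfin hF ht hs ?_)
  rintro _ rfl
  exact hb

end Attractor

/-! ### Determinacy -/

/-- The total memoryless strategy that chooses the successor `F s` of `s`. -/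
def Strategy.ofMap (F : V → V) (hF : G.IsLegal x F) : G.Strategy x where
  move h := some (F h.cur)
  legal h hh t ht := by
    rw [← Option.some_inj.1 ht]; exact hF _ hh.1.1 hh.2

theorem Strategy.ofMap_isMemoryless {F : V → V} (hF : G.IsLegal x F) :
    (Strategy.ofMap F hF).IsMemoryless :=
  fun _ _ => rfl

theorem Strategy.ofMap_mem_finiteMemory {F : V → V} (hF : G.IsLegal x F) :
    Strategy.ofMap F hF ∈ G.finiteMemory x := by
  refine ⟨fun h _ => by simp [ofMap], Unit, inferInstance,
    { init := (), next := fun s _ => F s, update := fun _ _ => (),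
      legal := fun s hs ho _ => hF s hs ho }, fun _ _ => rfl⟩

/-- Since the strategy `F` is total, an objective has to be checked only for the profiles that
follow `F` and a finite memory structure of the opponent. -/
theorem mem_winSet_ofMap {F : V → V} (hF : G.IsLegal x F) {E : Set (ℕ → V)} {c : ℝ≥0∞ → Prop}
    {s : V} (hs : s ∈ G.states) (h : ∀ (M : Type) [Finite M] (𝓜 : G.MemoryStructure (1 - x) M)
      (σ : G.Profile), G.Follows σ x F 𝓜 → (∀ y, (σ y).IsTotal) → c (G.prob σ s E)) :
    s ∈ G.winSet (Strategy.ofMap F hF) (G.finiteMemory (1 - x)) E c := by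
  refine ⟨hs, fun g hg _ σ ht hf hσg => ?_⟩
  obtain ⟨-, M, _, 𝓜, h𝓜⟩ := hg
  exact h M 𝓜 σ ⟨fun h hh => hf h hh _ rfl, fun h hh => hσg h hh _ (h𝓜 h hh)⟩ ht

/-- There are arbitrarily large colors of each player. -/
theorem exists_ofNat_eq (n : ℕ) (y : Player) : ∃ m, n ≤ m ∧ y = Player.ofNat m := by
  by_cases h : y = Player.ofNat n
  · exact ⟨n, le_rfl, h⟩
  · refine ⟨n + 1, Nat.le_succ n, ?_⟩
    have h1 := Player.ofNat_succ n
    generalize Player.ofNat n = a at *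
    generalize Player.ofNat (n + 1) = b at *
    revert y a b
    decide

/-- Player `y` is the player of some bound `m ≥ n` on the colors. On `C_m` he wins almost surely,
and on the complement his opponent wins with positive probability. -/
theorem memorylessDetermined_AS {A : Set V} (hA : G.IsAttractor A) (hfin : A.Finite) {n : ℕ}
    (hn : G.HasRank n) (y : Player) : G.MemorylessDetermined y G.finiteMemory (G.parity y) AS := by
  intro s hs
  obtain ⟨m, hnm, hm⟩ := exists_ofNat_eq n y
  obtain ⟨F, F', hF, hF', -, h1, h2⟩ := exists_winning hfin m G
    (fun s hs => (hn s hs).trans hnm) hA.meetsClosable y (1 - y) hm rfl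
  by_cases hC : s ∈ C m G
  · exact .inl ⟨.ofMap F hF, Strategy.ofMap_mem_finiteMemory hF, Strategy.ofMap_isMemoryless hF,
      mem_winSet_ofMap hF hs fun M _ 𝓜 σ hσ ht => (h1 s hC).prob_eq_one hA hfin hF hσ ht hs⟩
  · refine .inr ⟨.ofMap F' hF', Strategy.ofMap_mem_finiteMemory hF',
      Strategy.ofMap_isMemoryless hF', mem_winSet_ofMap hF' hs fun M _ 𝓜 σ hσ ht h => ?_⟩
    have hpos := (h2 s ⟨hs, hC⟩).prob_pos hA hfin hF' hσ ht hs
    have hle := prob_parity_add_le σ y s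
    rw [AS] at h
    rw [h] at hle
    exact absurd hle (not_le.2 (ENNReal.lt_add_right ENNReal.one_ne_top hpos.ne'))

/-- Player `1 - y` is the player of some bound `m ≥ n` on the colors. On `C_m` he wins almost
surely, and on the complement Player `y` wins with positive probability. -/
theorem memorylessDetermined_WPP {A : Set V} (hA : G.IsAttractor A) (hfin : A.Finite) {n : ℕ}
    (hn : G.HasRank n) (y : Player) : G.MemorylessDetermined y G.finiteMemory (G.parity y) WPP := by
  intro s hs
  obtain ⟨m, hnm, hm⟩ := exists_ofNat_eq n (1 - y)
  obtain ⟨F, F', hF, hF', -, h1, h2⟩ := exists_winning hfin m G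
    (fun s hs => (hn s hs).trans hnm) hA.meetsClosable (1 - y) y hm
    (Player.one_sub_one_sub y).symm
  by_cases hC : s ∈ C m G
  · refine .inr ⟨.ofMap F hF, Strategy.ofMap_mem_finiteMemory hF,
      Strategy.ofMap_isMemoryless hF, mem_winSet_ofMap hF hs fun M _ 𝓜 σ hσ ht h => ?_⟩
    have hone := (h1 s hC).prob_eq_one hA hfin hF hσ ht hs
    have hle := prob_parity_add_le σ y s
    rw [hone, add_comm] at hle
    exact absurd hle (not_le.2 (ENNReal.lt_add_right ENNReal.one_ne_top (ne_of_gt h)))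
  · exact .inl ⟨.ofMap F' hF', Strategy.ofMap_mem_finiteMemory hF',
      Strategy.ofMap_isMemoryless hF', mem_winSet_ofMap hF' hs fun M _ 𝓜 σ hσ ht =>
        (h2 s ⟨hs, hC⟩).prob_pos hA hfin hF' hσ ht hs⟩

end StochasticGame

theorem mainTheorem1 {V : Type u} (G : StochasticGame V) (n : ℕ) (hn : G.HasRank n)
    (hA : ∃ A : Set V, A.Finite ∧ G.IsAttractor A) (x : Player) (hx : x = Player.ofNat n) :
    (∃ (f : G.Strategy x) (g : G.Strategy (1 - x)), f.IsMemoryless ∧ g.IsMemoryless ∧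
      StochasticGame.C n G ⊆
        G.winSet f (G.finiteMemory (1 - x)) (G.parity x) StochasticGame.AS ∧
      G.states \ StochasticGame.C n G ⊆
        G.winSet g (G.finiteMemory (1 - (1 - x))) (G.parity (1 - x)) StochasticGame.WPP) ∧
    ∀ y : Player,
      G.MemorylessDetermined y G.finiteMemory (G.parity y) StochasticGame.AS ∧
      G.MemorylessDetermined y G.finiteMemory (G.parity y) StochasticGame.WPP := by
  obtain ⟨A, hfin, hA⟩ := hA
  refine ⟨?_, fun y => ⟨StochasticGame.memorylessDetermined_AS hA hfin hn y,
    StochasticGame.memorylessDetermined_WPP hA hfin hn y⟩⟩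
  obtain ⟨F, F', hF, hF', -, h1, h2⟩ :=
    StochasticGame.exists_winning hfin n G hn hA.meetsClosable x (1 - x) hx rfl
  refine ⟨.ofMap F hF, .ofMap F' hF', StochasticGame.Strategy.ofMap_isMemoryless hF,
    StochasticGame.Strategy.ofMap_isMemoryless hF', fun s hs => ?_, fun s hs => ?_⟩
  · have hsG := StochasticGame.C_subset n G hs
    exact StochasticGame.mem_winSet_ofMap hF hsG fun M _ 𝓜 σ hσ ht =>
      (h1 s hs).prob_eq_one hA hfin hF hσ ht hsG
  · exact StochasticGame.mem_winSet_ofMap hF' hs.1 fun M _ 𝓜 σ hσ ht =>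
      (h2 s hs).prob_pos hA hfin hF' hσ ht hs.1
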